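/- Let $R$ be a commutative ring, $f\colon X\to Y$ a continuous map of topological spaces, and $I=[0,1]$. Write $S_\bullet(-)$ for singular chains with coefficients in $R$ ($S_n=0$ for $n<0$), and let $\operatorname{Cone}_\bullet(f_*)$ be the algebraic mapping cone of $f_*\colon S_\bullet(X)\to S_\bullet(Y)$: $$\operatorname{Cone}_n(f_*)=S_{n-1}(X)\oplus S_n(Y),\qquad \partial(x,y)=(\partial x,\;f_*x-\partial y),\qquad H_n(f):=H_n(\operatorname{Cone}_\bullet(f_*)).$$ Let $\operatorname{Cone}(X)=X\times I/X\times\{0\}$, $\operatorname{Cyl}_f=((X\times I)\sqcup Y)/((x,1)\sim f(x))$ and $\operatorname{Cone}_f=\operatorname{Cyl}_f/(X\times\{0\})$, with cone point $*$ (for $X=\emptyset$, a quotient $Z/\emptyset$ means $Z\sqcup\{*\}$), and let $i\colon Y\to\operatorname{Cone}_f$ and $j\colon\operatorname{Cone}(X)\to\operatorname{Cone}_f$ be the natural maps. Let $h\colon S_{n-1}(X)\to S_n(\operatorname{Cone}(X))$ replace each singular simplex $\sigma$ by its cone $$h(\sigma)(t_0,\dots,t_n)=\Big[\sigma\Big(\tfrac{(t_1,\dots,t_n)}{1-t_0}\Big),\,1-t_0\Big]\quad(t_0\neq1),$$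 with the vertex $t_0=1$ sent to the cone point. Define $$l_n\colon\operatorname{Cone}_n(f_*)\to S_n(\operatorname{Cone}_f),\qquad l_n(x,y)=j_*(h(x))-i_*(y).$$ Let $\pi\colon S_\bullet(\operatorname{Cone}_f)\to S_\bullet(\operatorname{Cone}_f,*)=S_\bullet(\operatorname{Cone}_f)/S_\bullet(*)$ be the quotient map, and let $\tilde H_n(Z)=\ker(H_n(Z)\to H_n(\mathrm{pt}))$ denote reduced homology. Then: 1. $l_\bullet$ is a chain map up to sign: $\partial\, l_{n+1}+l_n\,\partial=0$ on $\operatorname{Cone}_{n+1}(f_*)$ for all $n\ge1$; and $\partial\,(\pi l_{n+1})+(\pi l_n)\,\partial=0$ for all $n\ge0$. In particular $L_n:=(-1)^n\,\pi\circ l_n$ is a chain map $L\colon\operatorname{Cone}_\bullet(f_*)\to S_\bullet(\operatorname{Cone}_f,*)$. 2. $L$ is a quasi-isomorphism. 3. For every $n\ge0$ there is an isomorphism $H_n(f)\cong\tilde H_n(\operatorname{Cone}_f)$, and for every $n\ge1$ there is an isomorphism $H_n(f)\cong H_n(\operatorname{Cone}_f)$; in both cases its composition with the map to $H_n(\operatorname{Cone}_f,*)$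 induced by $\pi$ is the map induced by $L$. -/

import Mathlib

universe u

noncomputable section

namespace MappingCone

open CategoryTheory CategoryTheory.Limits AlgebraicTopology

/-! ### The algebraic mapping cone -/

section Algebraic

variable {R : Type u} [CommRing R] {A B : ChainComplex (ModuleCat.{u} R) ℕ} (f : A ⟶ B)

/-- `Cone_n(f) = A_{n-1} ⊕ B_n`, where `A_{-1} = 0`. -/
def algConeX (A B : ChainComplex (ModuleCat.{u} R) ℕ) : ℕ → ModuleCat.{u} R
  | 0 => B.X 0
  | n + 1 => ModuleCat.of R (A.X n × B.X (n + 1))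

/-- The differential `∂(θ, η) = (∂θ, f(θ) - ∂η)` of the algebraic mapping cone; in degree one
the first component is absent since `A_{-1} = 0`. -/
def algConeD : ∀ n : ℕ, algConeX A B (n + 1) ⟶ algConeX A B n
  | 0 => ModuleCat.ofHom
      ((f.f 0).hom ∘ₗ LinearMap.fst R (A.X 0) (B.X 1) -
        (B.d 1 0).hom ∘ₗ LinearMap.snd R (A.X 0) (B.X 1))
  | n + 1 => ModuleCat.ofHom
      (((A.d (n + 1) n).hom ∘ₗ LinearMap.fst R (A.X (n + 1)) (B.X (n + 2))).prod
        ((f.f (n + 1)).hom ∘ₗ LinearMap.fst R (A.X (n + 1)) (B.X (n + 2)) -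
          (B.d (n + 2) (n + 1)).hom ∘ₗ LinearMap.snd R (A.X (n + 1)) (B.X (n + 2))))

lemma algConeD_comp (n : ℕ) : algConeD f (n + 1) ≫ algConeD f n = 0 := by
  have hA : ∀ (i j k : ℕ) (x : A.X i), (A.d j k).hom ((A.d i j).hom x) = 0 := fun i j k x => by
    exact congrArg (fun g => g.hom x) (A.d_comp_d i j k)
  have hB : ∀ (i j k : ℕ) (x : B.X i), (B.d j k).hom ((B.d i j).hom x) = 0 := fun i j k x => by
    exact congrArg (fun g => g.hom x) (B.d_comp_d i j k)
  have hf : ∀ (i j : ℕ) (x : A.X i),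
      (B.d i j).hom ((f.f i).hom x) = (f.f j).hom ((A.d i j).hom x) := fun i j x => by
    exact congrArg (fun g => g.hom x) (f.comm i j)
  cases n with
  | zero =>
    refine ModuleCat.hom_ext (LinearMap.ext fun ⟨x, y⟩ => ?_)
    change (f.f 0).hom ((A.d 1 0).hom x) -
      (B.d 1 0).hom ((f.f 1).hom x - (B.d 2 1).hom y) = 0
    rw [map_sub, hB, hf, sub_zero, sub_self]
  | succ n =>
    refine ModuleCat.hom_ext (LinearMap.ext fun ⟨x, y⟩ => ?_)
    change ((A.d (n + 1) n).hom ((A.d (n + 2) (n + 1)).hom x),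
      (f.f (n + 1)).hom ((A.d (n + 2) (n + 1)).hom x) -
      (B.d (n + 2) (n + 1)).hom ((f.f (n + 2)).hom x - (B.d (n + 3) (n + 2)).hom y)) = 0
    rw [map_sub, hB, hA, hf, sub_zero, sub_self]
    rfl

/-- The algebraic mapping cone `Cone_•(f)` of a chain map. -/
def algCone : ChainComplex (ModuleCat.{u} R) ℕ :=
  ChainComplex.of (algConeX A B) (algConeD f) (algConeD_comp f)

end Algebraic

/-! ### Collapsing a subspace, the cone, the mapping cylinder and the mapping cone -/

section Topological

/-- The relation on `Z ⊔ pt` which identifies all points of `A` with the added point. -/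
inductive CollapseRel {Z : Type u} (A : Set Z) : Z ⊕ PUnit.{u + 1} → Z ⊕ PUnit.{u + 1} → Prop
  | glue (a : Z) (ha : a ∈ A) : CollapseRel A (Sum.inl a) (Sum.inr PUnit.unit)

/-- The quotient space `Z / A`. For nonempty `A` this is the quotient of `Z` in which `A` becomes
one point; `Z / ∅` is by convention `Z` with a disjoint base point. -/
def Collapse (Z : Type u) [TopologicalSpace Z] (A : Set Z) : TopCat.{u} :=
  TopCat.of (Quot (CollapseRel A))

/-- The class of a point of `Z` in `Z / A`. -/
def Collapse.mk {Z : Type u} [TopologicalSpace Z] (A : Set Z) (z : Z) : Collapse Z A :=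
  Quot.mk _ (Sum.inl z)

/-- The point `A / A` of `Z / A`. -/
def Collapse.base {Z : Type u} [TopologicalSpace Z] (A : Set Z) : Collapse Z A :=
  Quot.mk _ (Sum.inr PUnit.unit)

lemma Collapse.continuous_mk {Z : Type u} [TopologicalSpace Z] (A : Set Z) :
    Continuous (Collapse.mk A) :=
  continuous_quot_mk.comp continuous_inl

lemma Collapse.mk_eq_base {Z : Type u} [TopologicalSpace Z] {A : Set Z} {z : Z} (hz : z ∈ A) :
    Collapse.mk A z = Collapse.base A :=
  Quot.sound (CollapseRel.glue z hz)

/-- The map `Z / A → W / B` induced by a continuous map `Z → W` that sends `A` into `B`. -/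
def Collapse.map {Z W : Type u} [TopologicalSpace Z] [TopologicalSpace W] {A : Set Z} {B : Set W}
    (g : C(Z, W)) (hg : ∀ a ∈ A, g a ∈ B) : Collapse Z A ⟶ Collapse W B :=
  TopCat.ofHom
    { toFun := Quot.lift
        (Sum.elim (fun z => Collapse.mk B (g z)) (fun _ => Collapse.base B)) (by
          rintro _ _ ⟨a, ha⟩
          exact Collapse.mk_eq_base (hg a ha))
      continuous_toFun := continuous_quot_lift _
        (((Collapse.continuous_mk B).comp g.continuous).sumElim continuous_const) }

variable (X : TopCat.{u}) {Y : TopCat.{u}} (f : X ⟶ Y)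

/-- The cone `Cone(X) = X × I / X × {0}`. -/
def ConeSpace : TopCat.{u} :=
  Collapse (X × unitInterval) {p | p.2 = 0}

/-- The cone point of `Cone(X)`. -/
def coneApex : ConeSpace X := Collapse.base _

/-- The quotient map `X × I → Cone(X)`. -/
def coneMk : C(X × unitInterval, ConeSpace X) := ⟨Collapse.mk _, Collapse.continuous_mk _⟩

lemma coneMk_eq_apex (p : X × unitInterval) (hp : p.2 = 0) : coneMk X p = coneApex X :=
  Collapse.mk_eq_base hp

variable {X}

/-- The relation `(x, 1) ∼ f(x)` on `(X × I) ⊔ Y`. -/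
inductive CylRel : (X × unitInterval) ⊕ Y → (X × unitInterval) ⊕ Y → Prop
  | glue (x : X) : CylRel (Sum.inl (x, 1)) (Sum.inr (f x))

/-- The mapping cylinder `Cyl_f = ((X × I) ⊔ Y) / ((x, 1) ∼ f(x))`. -/
def MappingCyl : TopCat.{u} := TopCat.of (Quot (CylRel f))

/-- The natural map `X × I → Cyl_f`. -/
def cylInl : C(X × unitInterval, MappingCyl f) where
  toFun p := Quot.mk _ (Sum.inl p)
  continuous_toFun := continuous_quot_mk.comp continuous_inl

/-- The natural map `Y → Cyl_f`. -/
def cylInr : C(Y, MappingCyl f) where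
  toFun y := Quot.mk _ (Sum.inr y)
  continuous_toFun := continuous_quot_mk.comp continuous_inr

/-- The topological mapping cone `Cone_f = Cyl_f / X × {0}`. -/
def MappingConeSpace : TopCat.{u} :=
  Collapse (MappingCyl f) (cylInl f '' {p | p.2 = 0})

/-- The cone point of `Cone_f`. -/
def mappingConeApex : MappingConeSpace f := Collapse.base _

/-- The natural map `i : Y → Cone_f`. -/
def mapI : Y ⟶ MappingConeSpace f :=
  TopCat.ofHom ⟨fun y => Collapse.mk _ (cylInr f y),
    (Collapse.continuous_mk _).comp (cylInr f).continuous⟩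

/-- The natural map `j : Cone(X) → Cone_f`. -/
def mapJ : ConeSpace X ⟶ MappingConeSpace f :=
  Collapse.map (cylInl f) fun _ hp => Set.mem_image_of_mem _ hp

/-- The inclusion of the cone point into `Cone_f`. -/
def apexInclusion : TopCat.of PUnit.{u + 1} ⟶ MappingConeSpace f :=
  TopCat.ofHom (ContinuousMap.const _ (mappingConeApex f))

end Topological

/-! ### The cone of a singular simplex -/

section ConeSimplex

/-- The topological standard simplex with vertices `0, …, n`. -/
abbrev Simp (n : ℕ) : Type := stdSimplex ℝ (Fin (n + 1))

lemma simp_zero_add {n : ℕ} (t : Simp (n + 1)) : t.1 0 + ∑ i : Fin (n + 1), t.1 i.succ = 1 := by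
  rw [← Fin.sum_univ_succ]; exact t.2.2

/-- The height `1 - t₀` of a point `t` of the simplex above the vertex `0`. -/
def height {n : ℕ} (t : Simp (n + 1)) : unitInterval :=
  ⟨1 - t.1 0, sub_nonneg.2 (mem_Icc_of_mem_stdSimplex t.2 0).2,
    sub_le_self _ (t.2.1 0)⟩

/-- The projection `t ↦ (t₁, …, tₙ₊₁) / (1 - t₀)` of the simplex from the vertex `0` to the
opposite face. -/
def proj {n : ℕ} (t : Simp (n + 1)) (ht : t.1 0 ≠ 1) : Simp n :=
  ⟨fun i => t.1 i.succ / (1 - t.1 0),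
    fun i => div_nonneg (t.2.1 _) (sub_nonneg.2 (mem_Icc_of_mem_stdSimplex t.2 0).2), by
      have h := simp_zero_add t
      rw [← Finset.sum_div, div_eq_one_iff_eq (sub_ne_zero.2 (Ne.symm ht))]
      linarith⟩

variable {X : TopCat.{u}} {n : ℕ}

open Classical in
/-- The cone over `σ`: it sends `t ≠ e₀` to the class of `(σ((t₁, …, tₙ₊₁) / (1 - t₀)), 1 - t₀)`,
and the vertex `e₀` to the cone point. -/
def coneFun (σ : C(Simp n, X)) (t : Simp (n + 1)) : ConeSpace X :=
  if ht : t.1 0 = 1 then coneApex X else coneMk X (σ (proj t ht), height t)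

/-- The map `(s, r) ↦ (1 - r, r s)` from the prism onto the simplex. -/
def joinMap (n : ℕ) (p : Simp n × unitInterval) : Simp (n + 1) :=
  ⟨Fin.cons (1 - (p.2 : ℝ)) fun i => (p.2 : ℝ) * p.1.1 i, fun i => by
      refine Fin.cases ?_ (fun i => ?_) i
      · simpa using p.2.2.2
      · simpa using mul_nonneg p.2.2.1 (p.1.2.1 i), by
      rw [Fin.sum_univ_succ]
      simp only [Fin.cons_zero, Fin.cons_succ]
      rw [← Finset.mul_sum, p.1.2.2]
      ring⟩

lemma joinMap_zero (p : Simp n × unitInterval) : (joinMap n p).1 0 = 1 - (p.2 : ℝ) := rfl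

lemma joinMap_succ (p : Simp n × unitInterval) (i : Fin (n + 1)) :
    (joinMap n p).1 i.succ = (p.2 : ℝ) * p.1.1 i := rfl

lemma continuous_joinMap : Continuous (joinMap n) := by
  refine Continuous.subtype_mk (continuous_pi fun i => ?_) _
  refine Fin.cases ?_ (fun i => ?_) i
  · simp only [Fin.cons_zero]; fun_prop
  · simp only [Fin.cons_succ]
    exact (continuous_subtype_val.comp continuous_snd).mul
      ((continuous_apply i).comp (continuous_subtype_val.comp continuous_fst))

lemma surjective_joinMap : Function.Surjective (joinMap n) := by
  intro t
  by_cases ht : t.1 0 = 1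
  · refine ⟨(⟨_, single_mem_stdSimplex ℝ 0⟩, 0), Subtype.ext (funext fun i => ?_)⟩
    have h := simp_zero_add t
    have h0 : ∑ i : Fin (n + 1), t.1 i.succ = 0 := by linarith
    rw [Finset.sum_eq_zero_iff_of_nonneg fun i _ => t.2.1 i.succ] at h0
    refine Fin.cases ?_ (fun i => ?_) i
    · rw [joinMap_zero, ht]; simp
    · rw [joinMap_succ, h0 i (Finset.mem_univ i)]; simp
  · refine ⟨(proj t ht, height t), Subtype.ext (funext fun i => ?_)⟩
    refine Fin.cases ?_ (fun i => ?_) i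
    · rw [joinMap_zero]; simp [height]
    · rw [joinMap_succ]
      exact mul_div_cancel₀ _ (sub_ne_zero.2 (Ne.symm ht))

lemma coneFun_joinMap (σ : C(Simp n, X)) (p : Simp n × unitInterval) :
    coneFun σ (joinMap n p) = coneMk X (σ p.1, p.2) := by
  by_cases hp : p.2 = 0
  · have h1 : (joinMap n p).1 0 = 1 := by rw [joinMap_zero, hp]; simp
    rw [coneFun, dif_pos h1]
    exact (coneMk_eq_apex X _ hp).symm
  · have hp' : (p.2 : ℝ) ≠ 0 := fun h => hp (Subtype.ext h)
    have h1 : (joinMap n p).1 0 ≠ 1 := by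
      rw [joinMap_zero]; intro h; exact hp' (by linarith)
    have h2 : proj (joinMap n p) h1 = p.1 := by
      refine Subtype.ext (funext fun i => ?_)
      change (joinMap n p).1 i.succ / (1 - (joinMap n p).1 0) = p.1.1 i
      rw [joinMap_succ, joinMap_zero, sub_sub_cancel]
      exact mul_div_cancel_left₀ _ hp'
    have h3 : height (joinMap n p) = p.2 :=
      Subtype.ext (by change 1 - (joinMap n p).1 0 = _; rw [joinMap_zero, sub_sub_cancel])
    rw [coneFun, dif_neg h1, h2, h3]

lemma continuous_coneFun (σ : C(Simp n, X)) : Continuous (coneFun σ) := by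
  have hq : Topology.IsQuotientMap (joinMap n) :=
    continuous_joinMap.isClosedMap.isQuotientMap continuous_joinMap surjective_joinMap
  rw [hq.continuous_iff]
  have h : coneFun σ ∘ joinMap n = fun p => coneMk X (σ p.1, p.2) :=
    funext (coneFun_joinMap σ)
  rw [h]
  exact (coneMk X).continuous.comp (by fun_prop)

open Simplicial in
/-- The cone over a singular `n`-simplex of `X`, as a singular `(n + 1)`-simplex of `Cone(X)`. -/
def coneSimplex (σ : (TopCat.toSSet.obj X) _⦋n⦌) : (TopCat.toSSet.obj (ConeSpace X)) _⦋n + 1⦌ :=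
  (TopCat.toSSetObjEquiv (ConeSpace X) (Opposite.op ⦋n + 1⦌)).symm
    ⟨coneFun (TopCat.toSSetObjEquiv X (Opposite.op ⦋n⦌) σ), continuous_coneFun _⟩

end ConeSimplex

/-! ### Singular chains and the map `l` -/

section Singular

variable (R : Type u) [CommRing R] {X Y : TopCat.{u}} (f : X ⟶ Y)

/-- The singular chain complex `S_•(X)` with coefficients in `R`: the chain complex of the singular
simplicial set of `X` (it is definitionally Mathlib's singular chain complex). -/
abbrev S (X : TopCat.{u}) : ChainComplex (ModuleCat.{u} R) ℕ :=
  (TopCat.toSSet.obj X).chainComplex (ModuleCat.of R R)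

/-- The chain map `f_* : S_•(X) → S_•(Y)`. -/
abbrev pushforward : S R X ⟶ S R Y :=
  SSet.chainComplexMap (TopCat.toSSet.map f) (ModuleCat.of R R)

/-- The map `h : S_n(X) → S_{n+1}(Cone(X))` that replaces each singular simplex by its cone. -/
def coneOp (X : TopCat.{u}) (n : ℕ) : (S R X).X n ⟶ (S R (ConeSpace X)).X (n + 1) :=
  ((TopCat.toSSet.obj X).isColimitChainComplexXCofan (ModuleCat.of R R) n).desc
    (Cofan.mk _ fun σ =>
      (TopCat.toSSet.obj (ConeSpace X)).ιChainComplex (R := ModuleCat.of R R) (coneSimplex σ))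

/-- The map `l_n : Cone_n(f_*) → S_n(Cone_f)`, `(x, y) ↦ j_*(h(x)) - i_*(y)`. -/
def l : ∀ n : ℕ, (algCone (pushforward R f)).X n ⟶ (S R (MappingConeSpace f)).X n
  | 0 => -(pushforward R (mapI f)).f 0
  | n + 1 => ModuleCat.ofHom
      ((coneOp R X n ≫ (pushforward R (mapJ f)).f (n + 1)).hom ∘ₗ
          LinearMap.fst R ((S R X).X n) ((S R Y).X (n + 1)) -
        ((pushforward R (mapI f)).f (n + 1)).hom ∘ₗ
          LinearMap.snd R ((S R X).X n) ((S R Y).X (n + 1)))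

/-- The relative homology `H_n(f)` of a continuous map: the homology of `Cone_•(f_*)`. -/
abbrev mapHomology (n : ℕ) : ModuleCat.{u} R := (algCone (pushforward R f)).homology n

/-- The singular chains `S_•(Cone_f, *) = S_•(Cone_f) / S_•(*)` of the mapping cone relative to
its cone point `*`. -/
abbrev relChains : ChainComplex (ModuleCat.{u} R) ℕ :=
  cokernel (pushforward R (apexInclusion f))

/-- The quotient chain map `S_•(Cone_f) → S_•(Cone_f, *)`. -/
abbrev toRel : S R (MappingConeSpace f) ⟶ relChains R f :=
  cokernel.π (pushforward R (apexInclusion f))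

/-- The map `H_n(Z) → H_n(pt)` induced by `Z → pt`. -/
abbrev toPointHomology (Z : TopCat.{u}) (n : ℕ) :
    (S R Z).homology n ⟶ (S R (TopCat.of PUnit.{u + 1})).homology n :=
  HomologicalComplex.homologyMap
    (pushforward R (TopCat.ofHom (ContinuousMap.const Z PUnit.unit))) n

/-- The reduced homology of `Z`: the kernel of `H_n(Z) → H_n(pt)`. -/
abbrev reducedHomology (Z : TopCat.{u}) (n : ℕ) : ModuleCat.{u} R :=
  kernel (toPointHomology R Z n)

end Singular

end MappingCone

end

/-! Both sides are extensions of the same shape. Algebraically, Cone_•(f_*) is an extension of the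
shifted chains of X by S_•(Y) (`algCone_shortExact`). Geometrically, the complement of the cone
point in Cone_f is the open mapping cylinder, and dividing S_•(Cone_f, *) by its chains leaves
`localChains`, which only sees a neighbourhood of the cone point. L is a map between these
extensions (`mapLShort`). On the subcomplexes it is minus the inclusion of Y into the open cylinder,
a quasi-isomorphism because the cylinder deformation retracts onto Y. By the five lemma
(`quasiIso_τ₂`) it remains to treat the quotients, that is `shiftToLocal`.

Near the cone point Cone_f depends on X alone, so f may be compared with the identity of X. The map
Cone_id → Cone_f is a homeomorphism between the open parts of height less than one, so by excision
it is a quasi-isomorphism on local chains (`quasiIso_localCompare`), and it is compatible with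
`shiftToLocal` (`shiftToLocal_compare`). For the identity, both middle terms are acyclic: the
algebraic cone because the identity is bijective, the relative chains because Cone_id contracts to
its cone point. Hence L is a quasi-isomorphism for the identity, and the five lemma, read in the
other direction, gives `shiftToLocal` for the identity and then for f.

Excision rests on barycentric subdivision. Its identities are proved for formal ordered tuples of
points of a simplex, where coning makes them short inductions, and are carried to singular chains by
naturality under affine maps.

The sign identity for l is a computation of faces: face 0 of a coned simplex is the simplex in the
base, the other faces are cones over its faces. Only the cone over a 0-simplex has the cone point
itself as a face, and this defect dies under π. The statements on homology follow because the cone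
point is a retract of Cone_f, and because a point has no homology in positive degrees. -/

noncomputable section

namespace MappingCone

open CategoryTheory CategoryTheory.Limits AlgebraicTopology

/-! ### The basis of singular simplices -/

section Chains

open Simplicial

variable (R : Type u) [CommRing R] {X Y : TopCat.{u}} {n : ℕ}

/-- The singular chain given by a single singular simplex. -/
def gen (σ : C(Simp n, X)) : (S R X).X n :=
  ((TopCat.toSSet.obj X).ιChainComplex (R := ModuleCat.of R R)
    ((TopCat.toSSetObjEquiv X (Opposite.op ⦋n⦌)).symm σ)).hom (1 : R)

/-- Singular chains as finitely supported functions on singular simplices. -/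
def chainRepr (X : TopCat.{u}) (n : ℕ) :
    (S R X).X n ⟶ ModuleCat.of R (C(Simp n, X) →₀ R) :=
  ((TopCat.toSSet.obj X).isColimitChainComplexXCofan (ModuleCat.of R R) n).desc
    (Cofan.mk _ fun σ => ModuleCat.ofHom
      (Finsupp.lsingle (TopCat.toSSetObjEquiv X (Opposite.op ⦋n⦌) σ)))

lemma chainRepr_gen (σ : C(Simp n, X)) :
    (chainRepr R X n).hom (gen R σ) = Finsupp.single σ 1 := by
  have h := ((TopCat.toSSet.obj X).isColimitChainComplexXCofan (ModuleCat.of R R) n).fac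
    (Cofan.mk _ fun σ => ModuleCat.ofHom
      (Finsupp.lsingle (TopCat.toSSetObjEquiv X (Opposite.op ⦋n⦌) σ)))
    ⟨(TopCat.toSSetObjEquiv X (Opposite.op ⦋n⦌)).symm σ⟩
  have h' := congrArg (fun g => g.hom (1 : R)) h
  refine h'.trans ?_
  change Finsupp.single (TopCat.toSSetObjEquiv X (Opposite.op ⦋n⦌)
    ((TopCat.toSSetObjEquiv X (Opposite.op ⦋n⦌)).symm σ)) (1 : R) = _
  rw [Equiv.apply_symm_apply]

lemma chain_hom_ext' {M : ModuleCat.{u} R} {g h : (S R X).X n ⟶ M}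
    (H : ∀ σ : C(Simp n, X), g.hom (gen R σ) = h.hom (gen R σ)) : g = h := by
  refine SSet.chainComplex_hom_ext fun x => ModuleCat.hom_ext (LinearMap.ext_ring ?_)
  have := H (TopCat.toSSetObjEquiv X (Opposite.op ⦋n⦌) x)
  rw [gen, Equiv.symm_apply_apply] at this
  exact this

/-- Singular simplices form a basis of the module of singular chains. -/
def chainBasis (X : TopCat.{u}) (n : ℕ) : Module.Basis C(Simp n, X) R ((S R X).X n) :=
  .ofRepr (LinearEquiv.ofLinearMap (chainRepr R X n).hom (Finsupp.linearCombination R (gen R))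
    (Finsupp.lhom_ext' fun σ => LinearMap.ext_ring <| by
      simp only [LinearMap.comp_apply, Finsupp.lsingle_apply, Finsupp.linearCombination_single,
        one_smul, LinearMap.id_apply]
      exact chainRepr_gen R σ)
    (congrArg ModuleCat.Hom.hom (chain_hom_ext' R
      (g := chainRepr R X n ≫ ModuleCat.ofHom (Finsupp.linearCombination R (gen R))) (h := 𝟙 _)
      fun σ => by
        change Finsupp.linearCombination R (gen R) ((chainRepr R X n).hom (gen R σ)) = gen R σ
        rw [chainRepr_gen, Finsupp.linearCombination_single, one_smul])))

@[simp]
lemma chainBasis_apply (σ : C(Simp n, X)) : chainBasis R X n σ = gen R σ := by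
  change Finsupp.linearCombination R (gen R) (Finsupp.single σ 1) = _
  rw [Finsupp.linearCombination_single, one_smul]

lemma chain_ext {M : Type*} [AddCommGroup M] [Module R M] {g h : (S R X).X n →ₗ[R] M}
    (H : ∀ σ : C(Simp n, X), g (gen R σ) = h (gen R σ)) : g = h :=
  (chainBasis R X n).ext fun σ => by rw [chainBasis_apply, H]

/-- The linear map on singular chains with prescribed values on singular simplices. -/
def chainLift {M : Type*} [AddCommGroup M] [Module R M] (φ : C(Simp n, X) → M) :
    (S R X).X n →ₗ[R] M :=
  (chainBasis R X n).constr ℕ φ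

@[simp]
lemma chainLift_gen {M : Type*} [AddCommGroup M] [Module R M] (φ : C(Simp n, X) → M)
    (σ : C(Simp n, X)) : chainLift R φ (gen R σ) = φ σ := by
  rw [← chainBasis_apply, chainLift, Module.Basis.constr_basis]

/-- The inclusion of the `i`-th face of the simplex. -/
def faceMap (n : ℕ) (i : Fin (n + 2)) : C(Simp n, Simp (n + 1)) :=
  ⟨stdSimplex.map i.succAbove, stdSimplex.continuous_map _⟩

lemma d_gen (σ : C(Simp (n + 1), X)) :
    ((S R X).d (n + 1) n).hom (gen R σ) =
      ∑ i : Fin (n + 2), (-1 : R) ^ (i : ℕ) • gen R (σ.comp (faceMap n i)) := by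
  have h := congrArg (fun g => g.hom (1 : R)) ((TopCat.toSSet.obj X).ιChainComplex_d
    (ModuleCat.of R R) ((TopCat.toSSetObjEquiv X (Opposite.op ⦋n + 1⦌)).symm σ))
  refine h.trans ?_
  rw [ModuleCat.hom_sum, LinearMap.sum_apply]
  refine Finset.sum_congr rfl fun i _ => ?_
  rw [ModuleCat.hom_zsmul, LinearMap.smul_apply, ← Int.cast_smul_eq_zsmul R]
  push_cast
  rfl

lemma pushforward_gen (f : X ⟶ Y) (σ : C(Simp n, X)) :
    ((pushforward R f).f n).hom (gen R σ) = gen R (f.hom.comp σ) :=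
  congrArg (fun g => g.hom (1 : R)) (SSet.ι_chainComplexMap_f (TopCat.toSSet.obj X)
    (TopCat.toSSet.obj Y) (TopCat.toSSet.map f) (ModuleCat.of R R)
    ((TopCat.toSSetObjEquiv X (Opposite.op ⦋n⦌)).symm σ))

/-- The cone over a singular simplex as a continuous map. -/
def coneMap (σ : C(Simp n, X)) : C(Simp (n + 1), ConeSpace X) :=
  ⟨coneFun σ, continuous_coneFun σ⟩

lemma coneOp_gen (σ : C(Simp n, X)) :
    (coneOp R X n).hom (gen R σ) = gen R (coneMap σ) := by
  have h := ((TopCat.toSSet.obj X).isColimitChainComplexXCofan (ModuleCat.of R R) n).fac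
    (Cofan.mk _ fun σ =>
      (TopCat.toSSet.obj (ConeSpace X)).ιChainComplex (R := ModuleCat.of R R) (coneSimplex σ))
    ⟨(TopCat.toSSetObjEquiv X (Opposite.op ⦋n⦌)).symm σ⟩
  refine (congrArg (fun g => g.hom (1 : R)) h).trans ?_
  change ((TopCat.toSSet.obj (ConeSpace X)).ιChainComplex (R := ModuleCat.of R R)
    (coneSimplex _)).hom (1 : R) = _
  rw [gen]
  congr 3

/-! ### Chains spanned by a set of simplices -/

variable {R} in
/-- The chains spanned by the singular simplices which satisfy `p`. -/
def spanOf (p : C(Simp n, X) → Prop) : Submodule R ((S R X).X n) :=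
  Submodule.span R (gen R '' {σ | p σ})

variable {R}

lemma gen_mem_spanOf {p : C(Simp n, X) → Prop} {σ : C(Simp n, X)} (h : p σ) :
    gen R σ ∈ spanOf (R := R) p :=
  Submodule.subset_span ⟨σ, h, rfl⟩

/-- Simplices are linearly independent, so membership can be tested one coefficient at a time. -/
lemma mem_spanOf_iff {p : C(Simp n, X) → Prop} {z : (S R X).X n} :
    z ∈ spanOf p ↔ ∀ σ, (chainBasis R X n).repr z σ ≠ 0 → p σ := by
  have h : gen R '' {σ | p σ} = chainBasis R X n '' {σ | p σ} := by
    simp [Set.image]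
  rw [spanOf, h, Module.Basis.mem_span_image]
  simp [Set.subset_def]

lemma spanOf_or (p q : C(Simp n, X) → Prop) :
    spanOf (R := R) (fun σ => p σ ∨ q σ) = spanOf p ⊔ spanOf q := by
  rw [spanOf, spanOf, spanOf, ← Submodule.span_union, ← Set.image_union]
  rfl

lemma map_mem_of_spanOf {M : Type*} [AddCommGroup M] [Module R M] {g : (S R X).X n →ₗ[R] M}
    {N : Submodule R M} {p : C(Simp n, X) → Prop} (h : ∀ σ, p σ → g (gen R σ) ∈ N)
    {z : (S R X).X n} (hz : z ∈ spanOf p) : g z ∈ N := by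
  have : spanOf p ≤ N.comap g := Submodule.span_le.2 (by rintro _ ⟨σ, hσ, rfl⟩; exact h σ hσ)
  exact this hz

/-- If a map injects the simplices that satisfy `p`, then it reflects membership in spans on chains
of such simplices. -/
lemma mem_spanOf_of_pushforward {f : X ⟶ Y} {p q : C(Simp n, X) → Prop} {q' : C(Simp n, Y) → Prop}
    (hinj : ∀ σ τ, p σ → p τ → f.hom.comp σ = f.hom.comp τ → σ = τ)
    (hq : ∀ σ, p σ → q' (f.hom.comp σ) → q σ) {z : (S R X).X n} (hz : z ∈ spanOf p)
    (hfz : ((pushforward R f).f n).hom z ∈ spanOf q') : z ∈ spanOf q := by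
  rw [mem_spanOf_iff] at hz hfz ⊢
  intro σ hσ
  refine hq σ (hz σ hσ) (hfz _ ?_)
  -- By `hinj` no other simplex of the support of `z` has the same image as `σ`, so the coefficient
  -- of `z` at `σ` survives as the coefficient of its image at `f ∘ σ`.
  have key : ((pushforward R f).f n).hom z =
      ((chainBasis R X n).repr z).sum fun τ a => a • gen R (f.hom.comp τ) := by
    conv_lhs => rw [← (chainBasis R X n).linearCombination_repr z]
    rw [Finsupp.linearCombination_apply, Finsupp.sum, map_sum, Finsupp.sum]
    simp only [chainBasis_apply, map_smul, pushforward_gen]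
  rw [key, Finsupp.sum, map_sum, Finsupp.finsetSum_apply,
    Finset.sum_eq_single σ]
  · simpa [← chainBasis_apply] using hσ
  · intro τ hτ hne
    rw [map_smul, ← chainBasis_apply, Module.Basis.repr_self, Finsupp.smul_apply,
      Finsupp.single_eq_of_ne, smul_zero]
    intro h
    exact hne (hinj τ σ (hz τ (by simpa using hτ)) (hz σ hσ) h.symm)
  · intro h
    rw [Finsupp.notMem_support_iff.1 h, zero_smul, map_zero, Finsupp.zero_apply]

/-- The case of `mem_spanOf_of_pushforward` in which `q` and `q'` are never satisfied: the span of
no simplices is zero. -/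
lemma pushforward_injective {f : X ⟶ Y}
    (hinj : ∀ σ τ : C(Simp n, X), f.hom.comp σ = f.hom.comp τ → σ = τ) :
    Function.Injective ((pushforward R f).f n).hom := by
  rw [injective_iff_map_eq_zero]
  intro z hz
  have h : z ∈ spanOf fun _ : C(Simp n, X) => False := by
    refine mem_spanOf_of_pushforward (f := f) (p := fun _ => True) (q' := fun _ => False)
      (fun σ τ _ _ h => hinj σ τ h) (fun _ _ h => h) (mem_spanOf_iff.2 fun _ _ => trivial) ?_
    rw [hz]; exact zero_mem _
  simpa [spanOf] using h

/-- Chains that are supported in the subset `A`. -/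
def subChains (R : Type u) [CommRing R] {X : TopCat.{u}} (A : Set X) (n : ℕ) :
    Submodule R ((S R X).X n) :=
  spanOf fun σ => Set.range σ ⊆ A

end Chains

/-! ### Affine simplices -/

section Affine

variable {n k m : ℕ}

/-- The affine simplex with given vertices in a standard simplex. -/
def aff (v : Fin (n + 1) → Simp k) : C(Simp n, Simp k) where
  toFun t := ⟨∑ i, t.1 i • (v i).1, (convex_stdSimplex ℝ _).sum_mem (fun i _ => t.2.1 i) t.2.2
    fun i _ => (v i).2⟩
  continuous_toFun := by
    refine Continuous.subtype_mk (continuous_finsetSum _ fun i _ => ?_) _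
    exact ((continuous_apply i).comp continuous_subtype_val).smul continuous_const

lemma aff_coe (v : Fin (n + 1) → Simp k) (t : Simp n) :
    (aff v t).1 = ∑ i, t.1 i • (v i).1 := rfl

lemma faceMap_apply_self (i : Fin (n + 2)) (t : Simp n) : (faceMap n i t).1 i = 0 := by
  change FunOnFinite.linearMap ℝ ℝ i.succAbove t.1 i = 0
  rw [FunOnFinite.linearMap_apply_apply]
  exact Finset.sum_eq_zero fun j hj => by simp [Fin.succAbove_ne] at hj

lemma faceMap_apply_succAbove (i : Fin (n + 2)) (t : Simp n) (j : Fin (n + 1)) :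
    (faceMap n i t).1 (i.succAbove j) = t.1 j := by
  change FunOnFinite.linearMap ℝ ℝ i.succAbove t.1 (i.succAbove j) = t.1 j
  rw [FunOnFinite.linearMap_apply_apply, Finset.sum_eq_single j]
  · intro l hl hlj
    simp only [Finset.mem_filter, Finset.mem_univ, true_and] at hl
    exact absurd (Fin.succAbove_right_injective hl) hlj
  · simp

lemma aff_comp_faceMap (v : Fin (n + 2) → Simp k) (i : Fin (n + 2)) :
    (aff v).comp (faceMap n i) = aff (v ∘ i.succAbove) := by
  refine ContinuousMap.ext fun t => Subtype.ext ?_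
  rw [ContinuousMap.comp_apply, aff_coe, aff_coe, Fin.sum_univ_succAbove _ i, faceMap_apply_self,
    zero_smul, zero_add]
  simp only [faceMap_apply_succAbove, Function.comp_apply]

/-- The vertices of the standard simplex. -/
def vert (n : ℕ) (i : Fin (n + 1)) : Simp n := stdSimplex.vertex i

lemma aff_vert : aff (vert n) = ContinuousMap.id _ := by
  refine ContinuousMap.ext fun t => Subtype.ext (funext fun j => ?_)
  simp [aff_coe, vert, Pi.single_apply]

lemma aff_apply_aff (w : Fin (k + 1) → Simp m) (v : Fin (n + 1) → Simp k) (t : Simp n) :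
    aff w (aff v t) = aff (aff w ∘ v) t := by
  refine Subtype.ext ?_
  simp only [aff_coe, Function.comp_apply, Finset.sum_apply, Pi.smul_apply, smul_eq_mul,
    Finset.sum_smul, Finset.smul_sum, smul_smul]
  exact Finset.sum_comm

lemma aff_comp_aff (w : Fin (k + 1) → Simp m) (v : Fin (n + 1) → Simp k) :
    (aff w).comp (aff v) = aff (aff w ∘ v) :=
  ContinuousMap.ext (aff_apply_aff w v)

/-- The barycenter of an affine simplex. -/
def bary (v : Fin (n + 1) → Simp k) : Simp k := aff v stdSimplex.barycenter

lemma bary_comp (w : Fin (k + 1) → Simp m) (v : Fin (n + 1) → Simp k) :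
    bary (aff w ∘ v) = aff w (bary v) :=
  (aff_apply_aff w v _).symm

lemma bary_coe (v : Fin (n + 1) → Simp k) : (bary v).1 = ∑ i, ((n : ℝ) + 1)⁻¹ • (v i).1 := by
  rw [bary, aff_coe]
  simp

lemma bary_mem_convexHull (v : Fin (n + 1) → Simp k) :
    (bary v).1 ∈ convexHull ℝ (Set.range fun i => (v i).1) := by
  rw [bary, aff_coe]
  exact (convex_convexHull ℝ _).sum_mem (fun i _ => stdSimplex.barycenter.2.1 i)
    stdSimplex.barycenter.2.2 fun i _ => subset_convexHull _ _ ⟨i, rfl⟩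

/-- Closed balls are convex, so only the vertices matter. There `v i - bary v` is the mean of the `n
+ 1` differences `v i - v j`, one of which is zero; hence the factor `n / (n + 1)`. -/
lemma dist_bary_le (v : Fin (n + 1) → Simp k) {ε : ℝ}
    (h : ∀ i j, dist (v i).1 (v j).1 ≤ ε) {x : Fin (k + 1) → ℝ}
    (hx : x ∈ convexHull ℝ (Set.range fun i => (v i).1)) :
    dist x (bary v).1 ≤ n / (n + 1) * ε := by
  have hsub : convexHull ℝ (Set.range fun i => (v i).1) ⊆
      Metric.closedBall (bary v).1 (n / (n + 1) * ε) := by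
    refine convexHull_min ?_ (convex_closedBall _ _)
    rintro _ ⟨i, rfl⟩
    rw [Metric.mem_closedBall, dist_eq_norm]
    have hn : (0 : ℝ) < n + 1 := by positivity
    have h1 : (v i).1 - (bary v).1 = ((n : ℝ) + 1)⁻¹ • ∑ j, ((v i).1 - (v j).1) := by
      rw [bary_coe, Finset.sum_sub_distrib, smul_sub, Finset.smul_sum, Finset.smul_sum]
      congr 1
      rw [Finset.sum_const, Finset.card_univ, Fintype.card_fin, ← Nat.cast_smul_eq_nsmul ℝ,
        smul_smul]
      push_cast
      rw [mul_inv_cancel₀ hn.ne', one_smul]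
    rw [h1, norm_smul, Fin.sum_univ_succAbove _ i, sub_self, zero_add, Real.norm_of_nonneg
      (by positivity)]
    have h2 : ‖∑ j : Fin n, ((v i).1 - (v (i.succAbove j)).1)‖ ≤ n * ε := by
      refine (norm_sum_le_of_le (f := fun j : Fin n => (v i).1 - (v (i.succAbove j)).1)
        Finset.univ fun j _ => (dist_eq_norm _ _).symm.trans_le (h _ _)).trans ?_
      simp
    calc ((n : ℝ) + 1)⁻¹ * _ ≤ ((n : ℝ) + 1)⁻¹ * (n * ε) := by gcongr
      _ = _ := by field_simp
  exact hsub hx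

end Affine

/-! ### Ordered tuples of points and their barycentric subdivision -/

section Tuples

variable (R : Type u) [CommRing R]

/-- Chains of ordered `n`-tuples. -/
abbrev Tup (P : Type) (n : ℕ) : Type u := (Fin n → P) →₀ R

variable {R} {P Q : Type}

/-- The tuple `v` as a chain. -/
abbrev tup {n : ℕ} (v : Fin n → P) : Tup R P n := Finsupp.single v 1

lemma tup_ext {n : ℕ} {M : Type*} [AddCommGroup M] [Module R M] {g h : Tup R P n →ₗ[R] M}
    (H : ∀ v, g (tup v) = h (tup v)) : g = h :=
  Finsupp.lhom_ext' fun v => LinearMap.ext_ring (H v)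

/-- The map of tuples induced by a map of points. -/
def tupMap (g : P → Q) (n : ℕ) : Tup R P n →ₗ[R] Tup R Q n :=
  Finsupp.lmapDomain R R fun v => g ∘ v

@[simp]
lemma tupMap_tup (g : P → Q) {n : ℕ} (v : Fin n → P) :
    tupMap (R := R) g n (tup v) = tup (g ∘ v) := by
  simp [tupMap]

/-- The (augmented) boundary of tuples. -/
def tupD (n : ℕ) : Tup R P (n + 1) →ₗ[R] Tup R P n :=
  ∑ i : Fin (n + 1), (-1 : R) ^ (i : ℕ) • Finsupp.lmapDomain R R fun v => v ∘ i.succAbove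

lemma tupD_tup {n : ℕ} (v : Fin (n + 1) → P) :
    tupD (R := R) n (tup v) = ∑ i : Fin (n + 1), (-1 : R) ^ (i : ℕ) • tup (v ∘ i.succAbove) := by
  simp [tupD]

/-- The cone with vertex `b`. -/
def tupCone (b : P) (n : ℕ) : Tup R P n →ₗ[R] Tup R P (n + 1) :=
  Finsupp.lmapDomain R R fun v => (Fin.cons b v : Fin (n + 1) → P)

@[simp]
lemma tupCone_tup (b : P) {n : ℕ} (v : Fin n → P) :
    tupCone (R := R) b n (tup v) = tup (Fin.cons b v : Fin (n + 1) → P) := by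
  simp [tupCone]

lemma tupD_map (g : P → Q) {n : ℕ} (z : Tup R P (n + 1)) :
    tupD n (tupMap g (n + 1) z) = tupMap g n (tupD n z) := by
  have : tupD n ∘ₗ tupMap g (n + 1) = tupMap (R := R) g n ∘ₗ tupD n := tup_ext fun v => by
    simp only [LinearMap.comp_apply, tupMap_tup, tupD_tup, map_sum, map_smul, Function.comp_assoc]
  exact LinearMap.congr_fun this z

lemma tupCone_map (g : P → Q) (b : P) {n : ℕ} (z : Tup R P n) :
    tupCone (g b) n (tupMap g n z) = tupMap g (n + 1) (tupCone b n z) := by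
  have : tupCone (g b) n ∘ₗ tupMap g n = tupMap (R := R) g (n + 1) ∘ₗ tupCone b n :=
    tup_ext fun v => by simp [Fin.comp_cons]
  exact LinearMap.congr_fun this z

/-- Here `n`-tuples have dimension `n - 1`, and the empty tuple spans the augmentation term. It has
no boundary, so the cone formula loses its last term. -/
lemma tupD_cone_zero (b : P) (z : Tup R P 0) : tupD 0 (tupCone b 0 z) = z := by
  have : tupD 0 ∘ₗ tupCone b 0 = (LinearMap.id : Tup R P 0 →ₗ[R] Tup R P 0) :=
    tup_ext fun v => by
      simp only [LinearMap.comp_apply, tupCone_tup, tupD_tup, LinearMap.id_apply]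
      simp [Subsingleton.elim _ v]
  exact LinearMap.congr_fun this z

/-- Deleting the cone vertex returns the tuple; deleting a later entry gives the cone over a face,
with the opposite sign. -/
lemma tupD_cone (b : P) {n : ℕ} (z : Tup R P (n + 1)) :
    tupD (n + 1) (tupCone b (n + 1) z) = z - tupCone b n (tupD n z) := by
  have : tupD (n + 1) ∘ₗ tupCone b (n + 1) =
      (LinearMap.id : Tup R P (n + 1) →ₗ[R] _) - tupCone b n ∘ₗ tupD n := tup_ext fun v => by
    have h0 : (Fin.cons b v : Fin (n + 2) → P) ∘ Fin.succ = v := by ext; simp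
    have h1 : ∀ i : Fin (n + 1), (Fin.cons b v : Fin (n + 2) → P) ∘ i.succ.succAbove =
        (Fin.cons b (v ∘ i.succAbove) : Fin (n + 1) → P) := fun i => by
      ext j
      refine Fin.cases ?_ (fun j => ?_) j
      · simp
      · simp
    simp only [LinearMap.comp_apply, LinearMap.sub_apply, LinearMap.id_apply, tupCone_tup, tupD_tup,
      map_sum, map_smul]
    rw [Fin.sum_univ_succ]
    simp [h0, h1, pow_succ, sub_eq_add_neg]
  exact LinearMap.congr_fun this z

/-- A nonempty tuple is the cone over its tail with vertex its head, so the cone formula gives an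
induction in place of the usual double sum over faces. -/
lemma tupD_tupD : ∀ {n : ℕ} (z : Tup R P (n + 2)), tupD n (tupD (n + 1) z) = 0 := by
  intro n
  suffices tupD n ∘ₗ tupD (n + 1) = (0 : Tup R P (n + 2) →ₗ[R] _) from LinearMap.congr_fun this
  induction n with
  | zero =>
    refine tup_ext fun v => ?_
    rw [← Fin.cons_self_tail v, ← tupCone_tup, LinearMap.comp_apply, tupD_cone, map_sub,
      tupD_cone_zero, sub_self, LinearMap.zero_apply]
  | succ n ih =>
    refine tup_ext fun v => ?_
    rw [← Fin.cons_self_tail v, ← tupCone_tup, LinearMap.comp_apply, tupD_cone, map_sub, tupD_cone]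
    have := LinearMap.congr_fun ih (tup (Fin.tail v))
    simp only [LinearMap.comp_apply, LinearMap.zero_apply] at this
    rw [this, map_zero, sub_zero, sub_self, LinearMap.zero_apply]

/-! ### Barycentric subdivision of tuples and its mesh. -/

variable {k m : ℕ}

/-- The barycentric subdivision of a tuple of points in a simplex. -/
def tupSd : ∀ n : ℕ, Tup R (Simp k) n →ₗ[R] Tup R (Simp k) n
  | 0 => LinearMap.id
  | n + 1 => Finsupp.linearCombination R fun v => tupCone (bary v) n (tupSd n (tupD n (tup v)))

/-- The homotopy between barycentric subdivision and the identity. -/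
def tupT : ∀ n : ℕ, Tup R (Simp k) n →ₗ[R] Tup R (Simp k) (n + 1)
  | 0 => 0
  | n + 1 => Finsupp.linearCombination R fun v =>
      tupCone (bary v) (n + 1) (tup v - tupT n (tupD n (tup v)))

lemma tupSd_tup {n : ℕ} (v : Fin (n + 1) → Simp k) :
    tupSd (R := R) (n + 1) (tup v) = tupCone (bary v) n (tupSd n (tupD n (tup v))) := by
  simp [tupSd]

lemma tupT_tup {n : ℕ} (v : Fin (n + 1) → Simp k) :
    tupT (R := R) (n + 1) (tup v) =
      tupCone (bary v) (n + 1) (tup v - tupT n (tupD n (tup v))) := by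
  simp [tupT]

/-- The cone formula gives `Sd ∂v` minus the cone over `∂ Sd ∂v`, and by induction the latter is `Sd
∂∂v = 0`. -/
lemma tupD_sd : ∀ {n : ℕ} (z : Tup R (Simp k) (n + 1)),
    tupD n (tupSd (n + 1) z) = tupSd n (tupD n z) := by
  intro n
  suffices tupD n ∘ₗ tupSd (n + 1) = tupSd n ∘ₗ tupD (R := R) (P := Simp k) n from
    LinearMap.congr_fun this
  induction n with
  | zero =>
    refine tup_ext fun v => ?_
    rw [LinearMap.comp_apply, tupSd_tup, tupD_cone_zero, LinearMap.comp_apply]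
  | succ n ih =>
    refine tup_ext fun v => ?_
    have h := LinearMap.congr_fun ih (tupD (n + 1) (tup v))
    rw [LinearMap.comp_apply, LinearMap.comp_apply, tupD_tupD, map_zero] at h
    rw [LinearMap.comp_apply, tupSd_tup, tupD_cone, h, map_zero, sub_zero, LinearMap.comp_apply]

/-- By induction `∂T∂v = ∂v - Sd ∂v`, so `v - T∂v` has boundary `Sd ∂v`, and the cone over that is
`Sd v`. -/
lemma tupD_T : ∀ {n : ℕ} (z : Tup R (Simp k) (n + 1)),
    tupD (n + 1) (tupT (n + 1) z) = z - tupSd (n + 1) z - tupT n (tupD n z) := by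
  intro n
  suffices tupD (n + 1) ∘ₗ tupT (n + 1) =
      LinearMap.id - tupSd (n + 1) - tupT n ∘ₗ tupD (R := R) (P := Simp k) n from
    LinearMap.congr_fun this
  induction n with
  | zero =>
    refine tup_ext fun v => ?_
    simp only [LinearMap.comp_apply, LinearMap.sub_apply, LinearMap.id_apply]
    rw [tupT_tup, tupD_cone, tupSd_tup]
    simp [tupT, tupSd]
  | succ n ih =>
    refine tup_ext fun v => ?_
    have h := LinearMap.congr_fun ih (tupD (n + 1) (tup v))
    simp only [LinearMap.comp_apply, LinearMap.sub_apply, LinearMap.id_apply, tupD_tupD,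
      map_zero, sub_zero] at h
    simp only [LinearMap.comp_apply, LinearMap.sub_apply, LinearMap.id_apply]
    rw [tupT_tup, tupD_cone, tupSd_tup, map_sub, h, sub_sub_cancel]
    abel

/-- Affine maps preserve barycenters. This naturality is what makes the operators well behaved on
singular simplices. -/
lemma tupSd_map (w : Fin (k + 1) → Simp m) : ∀ {n : ℕ} (z : Tup R (Simp k) n),
    tupSd n (tupMap (aff w) n z) = tupMap (aff w) n (tupSd n z) := by
  intro n
  suffices tupSd n ∘ₗ tupMap (aff w) n = tupMap (aff w) n ∘ₗ tupSd (R := R) n from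
    LinearMap.congr_fun this
  induction n with
  | zero => rfl
  | succ n ih =>
    refine tup_ext fun v => ?_
    have h := LinearMap.congr_fun ih (tupD n (tup v))
    rw [LinearMap.comp_apply, LinearMap.comp_apply] at h
    rw [LinearMap.comp_apply, LinearMap.comp_apply, tupMap_tup, tupSd_tup, tupSd_tup, bary_comp,
      ← tupMap_tup, tupD_map, h, tupCone_map]

lemma tupT_map (w : Fin (k + 1) → Simp m) : ∀ {n : ℕ} (z : Tup R (Simp k) n),
    tupT n (tupMap (aff w) n z) = tupMap (aff w) (n + 1) (tupT n z) := by
  intro n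
  suffices tupT n ∘ₗ tupMap (aff w) n = tupMap (aff w) (n + 1) ∘ₗ tupT (R := R) n from
    LinearMap.congr_fun this
  induction n with
  | zero => simp [tupT]
  | succ n ih =>
    refine tup_ext fun v => ?_
    have h := LinearMap.congr_fun ih (tupD n (tup v))
    rw [LinearMap.comp_apply, LinearMap.comp_apply] at h
    rw [LinearMap.comp_apply, LinearMap.comp_apply, tupMap_tup, tupT_tup, tupT_tup, bary_comp,
      ← tupMap_tup, tupD_map, h, ← map_sub, tupCone_map]

/-- The chains of tuples whose members have distance at most `ε`. -/
def meshLE (R : Type u) [CommRing R] (k n : ℕ) (ε : ℝ) : Submodule R (Tup R (Simp k) n) :=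
  Submodule.span R (tup '' {v | ∀ i j, dist (v i).1 (v j).1 ≤ ε})

/-- The hull condition is carried along for the sake of the induction: it bounds the distance from
the new barycenter to the points of the subdivided faces. -/
lemma tupSd_mem_span : ∀ {n : ℕ} (v : Fin n → Simp k) {ε : ℝ},
    (∀ i j, dist (v i).1 (v j).1 ≤ ε) → tupSd (R := R) n (tup v) ∈ Submodule.span R (tup ''
      {w | (∀ i, (w i).1 ∈ convexHull ℝ (Set.range fun i => (v i).1)) ∧
        ∀ i j, dist (w i).1 (w j).1 ≤ (1 - 1 / (n : ℝ)) * ε}) := by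
  intro n
  induction n with
  | zero => exact fun v ε _ => Submodule.subset_span ⟨v, ⟨fun i => i.elim0, fun i => i.elim0⟩, rfl⟩
  | succ n ih =>
    intro v ε hv
    have hε : 0 ≤ ε := by simpa using hv 0 0
    have hr : 1 - 1 / (((n + 1 : ℕ) : ℝ)) = n / (n + 1) := by
      have : (n : ℝ) + 1 ≠ 0 := by positivity
      push_cast
      field_simp
      ring
    rw [tupSd_tup, tupD_tup, map_sum, map_sum, hr]
    refine Submodule.sum_mem _ fun i _ => ?_
    rw [map_smul, map_smul]
    refine Submodule.smul_mem _ _ ?_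
    refine (Submodule.span_le (p := (Submodule.span R _).comap (tupCone (bary v) n))).2 ?_
      (ih (v ∘ i.succAbove) fun a b => hv _ _)
    rintro _ ⟨w, ⟨hw, hw'⟩, rfl⟩
    refine Submodule.subset_span ⟨_, ⟨?_, ?_⟩, (tupCone_tup _ _).symm⟩
    · have hw2 : ∀ j, (w j).1 ∈ convexHull ℝ (Set.range fun i => (v i).1) := fun j =>
        convexHull_mono (Set.range_comp_subset_range i.succAbove fun i => (v i).1) (hw j)
      exact Fin.cases (bary_mem_convexHull v) hw2
    · have hw2 : ∀ j, (w j).1 ∈ convexHull ℝ (Set.range fun i => (v i).1) := fun j =>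
        convexHull_mono (Set.range_comp_subset_range i.succAbove fun i => (v i).1) (hw j)
      have hc : 0 ≤ (n : ℝ) / (n + 1) * ε := by positivity
      refine Fin.cases (Fin.cases ?_ fun b => ?_) (fun a => Fin.cases ?_ fun b => ?_)
      · simpa using hc
      · simp only [Fin.cons_zero, Fin.cons_succ]
        rw [dist_comm]
        exact dist_bary_le v hv (hw2 b)
      · simp only [Fin.cons_zero, Fin.cons_succ]
        exact dist_bary_le v hv (hw2 a)
      · simp only [Fin.cons_succ]
        refine (hw' a b).trans ?_
        rw [← hr]
        -- A face has one entry fewer and hence the smaller ratio `1 - 1 / n`. The comparison needs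
        -- `n > 0`, which the index `a` supplies.
        have hn : (0 : ℝ) < n := by exact_mod_cast a.pos
        gcongr
        linarith

lemma tupSd_mem_meshLE {n : ℕ} {ε : ℝ} {z : Tup R (Simp k) n} (hz : z ∈ meshLE R k n ε) :
    tupSd n z ∈ meshLE R k n ((1 - 1 / (n : ℝ)) * ε) := by
  refine (Submodule.span_le (p := (meshLE R k n _).comap (tupSd n))).2 ?_ hz
  rintro _ ⟨v, hv, rfl⟩
  exact Submodule.span_mono (Set.image_mono fun w hw => hw.2) (tupSd_mem_span v hv)

lemma tupSd_pow_mem_meshLE {n : ℕ} {ε : ℝ} {z : Tup R (Simp k) n} (hz : z ∈ meshLE R k n ε)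
    (l : ℕ) : (tupSd n ^ l) z ∈ meshLE R k n ((1 - 1 / (n : ℝ)) ^ l * ε) := by
  induction l with
  | zero => simpa using hz
  | succ l ih =>
    rw [pow_succ', pow_succ', mul_assoc]
    exact tupSd_mem_meshLE ih

end Tuples

/-! ### Subdivision of singular chains -/

section Subdivision

variable {R : Type u} [CommRing R] {X Y : TopCat.{u}} {n k : ℕ}

/-- The singular chain of affine simplices in `σ` given by a chain of tuples. -/
def realize (σ : C(Simp k, X)) (n : ℕ) : Tup R (Simp k) (n + 1) →ₗ[R] (S R X).X n :=
  Finsupp.linearCombination R fun v => gen R (σ.comp (aff v))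

lemma realize_tup (σ : C(Simp k, X)) (v : Fin (n + 1) → Simp k) :
    realize (R := R) σ n (tup v) = gen R (σ.comp (aff v)) := by
  simp [realize]

lemma d_realize (σ : C(Simp k, X)) (z : Tup R (Simp k) (n + 2)) :
    ((S R X).d (n + 1) n).hom (realize σ (n + 1) z) = realize σ n (tupD (n + 1) z) := by
  have : ((S R X).d (n + 1) n).hom ∘ₗ realize σ (n + 1) = realize (R := R) σ n ∘ₗ tupD (n + 1) :=
    tup_ext fun v => by
      simp only [LinearMap.comp_apply, realize_tup, d_gen, tupD_tup, map_sum, map_smul,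
        ContinuousMap.comp_assoc, aff_comp_faceMap]
  exact LinearMap.congr_fun this z

lemma realize_comp_aff {m : ℕ} (σ : C(Simp k, X)) (w : Fin (m + 1) → Simp k)
    (z : Tup R (Simp m) (n + 1)) :
    realize (σ.comp (aff w)) n z = realize σ n (tupMap (aff w) (n + 1) z) := by
  have : realize (σ.comp (aff w)) n = realize (R := R) σ n ∘ₗ tupMap (aff w) (n + 1) :=
    tup_ext fun v => by
      rw [LinearMap.comp_apply, tupMap_tup, realize_tup, realize_tup, ContinuousMap.comp_assoc,
        aff_comp_aff]
  exact LinearMap.congr_fun this z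

lemma realize_mem (σ : C(Simp k, X)) (z : Tup R (Simp k) (n + 1)) {A : Set X}
    (h : Set.range σ ⊆ A) : realize σ n z ∈ subChains R A n := by
  rw [realize, Finsupp.linearCombination_apply]
  refine Submodule.sum_mem _ fun v _ => Submodule.smul_mem _ _ (gen_mem_spanOf ?_)
  rintro _ ⟨t, rfl⟩
  exact h ⟨_, rfl⟩

/-- The barycentric subdivision operator on singular chains. -/
def sd (n : ℕ) : (S R X).X n →ₗ[R] (S R X).X n :=
  chainLift R fun σ => realize σ n (tupSd (n + 1) (tup (vert n)))

/-- The homotopy between the identity and barycentric subdivision. -/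
def sdT (n : ℕ) : (S R X).X n →ₗ[R] (S R X).X (n + 1) :=
  chainLift R fun σ => realize σ (n + 1) (tupT (n + 1) (tup (vert n)))

/-- Every tuple is an affine image of the vertex tuple, so a natural operator is determined by its
value there. -/
lemma tupMap_vert (v : Fin (n + 1) → Simp k) :
    tupMap (R := R) (aff v) (n + 1) (tup (vert n)) = tup v := by
  rw [tupMap_tup]
  congr 1
  refine funext fun i => Subtype.ext ?_
  rw [Function.comp_apply, aff_coe, Finset.sum_eq_single i]
  · simp [vert]
  · intro j _ hj
    simp [vert, hj]
  · simp

/-- Subdividing an affine piece of `σ` as a singular simplex agrees with subdividing its tuple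
inside `σ`; thus identities between operators on tuples pass to singular chains. -/
lemma sd_realize (σ : C(Simp k, X)) (z : Tup R (Simp k) (n + 1)) :
    sd n (realize σ n z) = realize σ n (tupSd (n + 1) z) := by
  have : sd n ∘ₗ realize σ n = realize (R := R) σ n ∘ₗ tupSd (n + 1) := tup_ext fun v => by
    rw [LinearMap.comp_apply, LinearMap.comp_apply, realize_tup, sd, chainLift_gen,
      realize_comp_aff, ← tupSd_map, tupMap_vert]
  exact LinearMap.congr_fun this z

lemma sdT_realize (σ : C(Simp k, X)) (z : Tup R (Simp k) (n + 1)) :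
    sdT n (realize σ n z) = realize σ (n + 1) (tupT (n + 1) z) := by
  have : sdT n ∘ₗ realize σ n = realize (R := R) σ (n + 1) ∘ₗ tupT (n + 1) := tup_ext fun v => by
    rw [LinearMap.comp_apply, LinearMap.comp_apply, realize_tup, sdT, chainLift_gen,
      realize_comp_aff, ← tupT_map, tupMap_vert]
  exact LinearMap.congr_fun this z

lemma realize_vert (σ : C(Simp n, X)) : realize (R := R) σ n (tup (vert n)) = gen R σ := by
  rw [realize_tup, aff_vert, ContinuousMap.comp_id]

lemma d_sd (z : (S R X).X (n + 1)) :
    ((S R X).d (n + 1) n).hom (sd (n + 1) z) = sd n (((S R X).d (n + 1) n).hom z) := by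
  have : ((S R X).d (n + 1) n).hom ∘ₗ sd (n + 1) = sd n ∘ₗ ((S R X).d (n + 1) n).hom :=
    chain_ext R fun σ => by
      rw [LinearMap.comp_apply, LinearMap.comp_apply, ← realize_vert, sd_realize, d_realize,
        d_realize, sd_realize, tupD_sd]
  exact LinearMap.congr_fun this z

lemma d_sdT (z : (S R X).X (n + 1)) :
    ((S R X).d (n + 2) (n + 1)).hom (sdT (n + 1) z) + sdT n (((S R X).d (n + 1) n).hom z) =
      z - sd (n + 1) z := by
  have : ((S R X).d (n + 2) (n + 1)).hom ∘ₗ sdT (n + 1) + sdT n ∘ₗ ((S R X).d (n + 1) n).hom =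
      LinearMap.id - sd (n + 1) :=
    chain_ext R fun σ => by
      simp only [LinearMap.add_apply, LinearMap.sub_apply, LinearMap.comp_apply, LinearMap.id_apply]
      rw [← realize_vert, sd_realize, sdT_realize, d_realize,
        d_realize, sdT_realize, tupD_T, map_sub, map_sub, sub_add_cancel]
  exact LinearMap.congr_fun this z

lemma sd_mem {A : Set X} {z : (S R X).X n} (hz : z ∈ subChains R A n) :
    sd n z ∈ subChains R A n :=
  map_mem_of_spanOf (fun σ hσ => by rw [sd, chainLift_gen]; exact realize_mem σ _ hσ) hz

lemma sdT_mem {A : Set X} {z : (S R X).X n} (hz : z ∈ subChains R A n) :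
    sdT n z ∈ subChains R A (n + 1) :=
  map_mem_of_spanOf (fun σ hσ => by rw [sdT, chainLift_gen]; exact realize_mem σ _ hσ) hz

lemma sd_pow_mem {A : Set X} {z : (S R X).X n} (hz : z ∈ subChains R A n) (m : ℕ) :
    (sd n ^ m) z ∈ subChains R A n := by
  induction m with
  | zero => exact hz
  | succ m ih => rw [pow_succ']; exact sd_mem ih

lemma d_sd_pow (m : ℕ) (z : (S R X).X (n + 1)) :
    ((S R X).d (n + 1) n).hom ((sd (n + 1) ^ m) z) =
      (sd n ^ m) (((S R X).d (n + 1) n).hom z) := by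
  induction m with
  | zero => rfl
  | succ m ih => rw [pow_succ', pow_succ', Module.End.mul_apply, Module.End.mul_apply, d_sd, ih]

/-- The homotopy between the identity and an iterated barycentric subdivision. -/
def sdTPow (m n : ℕ) : (S R X).X n →ₗ[R] (S R X).X (n + 1) :=
  ∑ i ∈ Finset.range m, sdT n ∘ₗ (sd n ^ i)

/-- The sum telescopes: its `i`-th term contributes `sd ^ i z - sd ^ (i + 1) z`. -/
lemma d_sdTPow (m : ℕ) (z : (S R X).X (n + 1)) :
    ((S R X).d (n + 2) (n + 1)).hom (sdTPow m (n + 1) z) +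
      sdTPow m n (((S R X).d (n + 1) n).hom z) = z - (sd (n + 1) ^ m) z := by
  induction m with
  | zero => simp [sdTPow]
  | succ m ih =>
    have h := d_sdT ((sd (n + 1) ^ m) z)
    rw [d_sd_pow] at h
    rw [sdTPow, sdTPow, Finset.sum_range_succ, Finset.sum_range_succ, ← sdTPow, ← sdTPow,
      LinearMap.add_apply, LinearMap.add_apply, map_add, add_add_add_comm, ih,
      LinearMap.comp_apply, LinearMap.comp_apply, h, pow_succ', Module.End.mul_apply]
    abel

lemma sdTPow_mem {A : Set X} {z : (S R X).X n} (hz : z ∈ subChains R A n) (m : ℕ) :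
    sdTPow m n z ∈ subChains R A (n + 1) := by
  rw [sdTPow, LinearMap.sum_apply]
  exact Submodule.sum_mem _ fun i _ => sdT_mem (sd_pow_mem hz i)

/-- Once the mesh is below a Lebesgue number of the pulled-back cover, all vertices of an affine
piece lie in one small ball around the first of them. That ball is convex, so it contains the whole
piece. -/
lemma exists_sd_pow_gen_mem {U V : Set X} (hU : IsOpen U) (hV : IsOpen V)
    (hUV : U ∪ V = Set.univ) (σ : C(Simp n, X)) :
    ∃ m, (sd n ^ m) (gen R σ) ∈ subChains R U n ⊔ subChains R V n := by
  obtain ⟨δ, hδ, hL⟩ := lebesgue_number_lemma_of_metric (s := (Set.univ : Set (Simp n)))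
    (c := fun b : Bool => σ ⁻¹' (cond b U V)) isCompact_univ
    (fun b => by cases b <;> exact IsOpen.preimage σ.continuous ‹_›)
    (fun t _ => by
      have h : σ t ∈ U ∪ V := hUV ▸ Set.mem_univ _
      rcases h with h | h
      · exact Set.mem_iUnion.2 ⟨true, h⟩
      · exact Set.mem_iUnion.2 ⟨false, h⟩)
  have hn : (0 : ℝ) < ((n + 1 : ℕ) : ℝ) := by positivity
  obtain ⟨m, hm⟩ := exists_pow_lt_of_lt_one hδ (y := 1 - 1 / ((n + 1 : ℕ) : ℝ))
    (by have := one_div_pos.2 hn; linarith)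
  refine ⟨m, ?_⟩
  have hpow : ∀ (m : ℕ) (z : Tup R (Simp n) (n + 1)),
      (sd n ^ m) (realize σ n z) = realize σ n ((tupSd (n + 1) ^ m) z) := by
    intro m z
    induction m with
    | zero => rfl
    | succ m ih => rw [pow_succ', pow_succ', Module.End.mul_apply, ih, sd_realize]; rfl
  -- The distance is that of the sup norm and the coordinates lie in `[0, 1]`, so the initial mesh
  -- is at most 1.
  have hmesh : tup (vert n) ∈ meshLE R n (n + 1) 1 := by
    refine Submodule.subset_span ⟨_, fun i j => ?_, rfl⟩
    refine (dist_pi_le_iff zero_le_one).2 fun l => ?_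
    have h1 := mem_Icc_of_mem_stdSimplex (vert n i).2 l
    have h2 := mem_Icc_of_mem_stdSimplex (vert n j).2 l
    rw [Real.dist_eq, abs_le]
    constructor <;> linarith [h1.1, h1.2, h2.1, h2.2]
  have h := tupSd_pow_mem_meshLE hmesh m
  rw [← realize_vert, hpow]
  refine (Submodule.span_le (p := (subChains R U n ⊔ subChains R V n).comap (realize σ n))).2 ?_ h
  rintro _ ⟨v, hv, rfl⟩
  rw [SetLike.mem_coe, Submodule.mem_comap, realize_tup]
  obtain ⟨b, hb⟩ := hL (v 0) trivial
  have hr : Set.range (σ.comp (aff v)) ⊆ cond b U V := by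
    rintro _ ⟨t, rfl⟩
    refine hb ?_
    have hball : Convex ℝ (Metric.ball (v 0).1 δ) := convex_ball _ _
    exact hball.sum_mem (fun i _ => t.2.1 i) t.2.2 fun i _ => by
      refine (hv i 0).trans_lt ?_
      rwa [mul_one]
  cases b
  · exact Submodule.mem_sup_right (gen_mem_spanOf hr)
  · exact Submodule.mem_sup_left (gen_mem_spanOf hr)

lemma sd_pow_mem_sup {U V : Set X} {z : (S R X).X n}
    (hz : z ∈ subChains R U n ⊔ subChains R V n) (m : ℕ) :
    (sd n ^ m) z ∈ subChains R U n ⊔ subChains R V n := by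
  obtain ⟨u, hu, v, hv, rfl⟩ := Submodule.mem_sup.1 hz
  rw [map_add]
  exact Submodule.add_mem_sup (sd_pow_mem hu m) (sd_pow_mem hv m)

lemma exists_sd_pow_mem {U V : Set X} (hU : IsOpen U) (hV : IsOpen V)
    (hUV : U ∪ V = Set.univ) (z : (S R X).X n) :
    ∃ m, (sd n ^ m) z ∈ subChains R U n ⊔ subChains R V n := by
  have hz := (chainBasis R X n).mem_span z
  induction hz using Submodule.span_induction with
  | mem x h =>
    obtain ⟨σ, rfl⟩ := h
    rw [chainBasis_apply]
    exact exists_sd_pow_gen_mem hU hV hUV σ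
  | zero => exact ⟨0, by rw [map_zero]; exact zero_mem _⟩
  | add x y _ _ hx hy =>
    obtain ⟨a, ha⟩ := hx
    obtain ⟨b, hb⟩ := hy
    -- Further subdivision keeps small chains small, so the two exponents can be added.
    refine ⟨a + b, ?_⟩
    rw [map_add]
    refine add_mem ?_ ?_
    · rw [add_comm, pow_add]; exact sd_pow_mem_sup ha b
    · rw [pow_add]; exact sd_pow_mem_sup hb a
  | smul r x _ hx =>
    obtain ⟨a, ha⟩ := hx
    exact ⟨a, by rw [map_smul]; exact Submodule.smul_mem _ _ ha⟩

/-! ### Small chains and relative cycles for an open cover. -/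

/-- Chains supported in `U` or in `B`. -/
abbrev supChains (R : Type u) [CommRing R] {X : TopCat.{u}} (U B : Set X) (n : ℕ) :
    Submodule R ((S R X).X n) :=
  subChains R U n ⊔ subChains R B n

lemma d_subChains {A : Set X} {i j : ℕ} {z : (S R X).X i} (hz : z ∈ subChains R A i) :
    ((S R X).d i j).hom z ∈ subChains R A j := by
  by_cases hij : i = j + 1
  · subst hij
    refine map_mem_of_spanOf (g := ((S R X).d (j + 1) j).hom) (fun σ hσ => ?_) hz
    rw [d_gen]
    refine Submodule.sum_mem _ fun l _ => Submodule.smul_mem _ _ (gen_mem_spanOf ?_)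
    rintro _ ⟨t, rfl⟩
    exact hσ ⟨_, rfl⟩
  · rw [(S R X).shape i j (by rw [ComplexShape.down_Rel]; exact fun h => hij h.symm)]
    exact zero_mem _

lemma d_supChains {A B : Set X} {i j : ℕ} {z : (S R X).X i} (hz : z ∈ supChains R A B i) :
    ((S R X).d i j).hom z ∈ supChains R A B j := by
  obtain ⟨u, hu, v, hv, rfl⟩ := Submodule.mem_sup.1 hz
  rw [map_add]
  exact Submodule.add_mem_sup (d_subChains hu) (d_subChains hv)

lemma sdTPow_mem_sup {U V : Set X} {z : (S R X).X n}
    (hz : z ∈ supChains R U V n) (m : ℕ) : sdTPow m n z ∈ supChains R U V (n + 1) := by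
  obtain ⟨u, hu, v, hv, rfl⟩ := Submodule.mem_sup.1 hz
  rw [map_add]
  exact Submodule.add_mem_sup (sdTPow_mem hu m) (sdTPow_mem hv m)

lemma d_d_apply (K : ChainComplex (ModuleCat.{u} R) ℕ) (i j l : ℕ) (x : K.X i) :
    (K.d j l).hom ((K.d i j).hom x) = 0 :=
  congrArg (fun g => g.hom x) (K.d_comp_d i j l)

lemma hom_comm_apply {K L : ChainComplex (ModuleCat.{u} R) ℕ} (f : K ⟶ L) (i j : ℕ) (x : K.X i) :
    (L.d i j).hom ((f.f i).hom x) = (f.f j).hom ((K.d i j).hom x) :=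
  congrArg (fun g => g.hom x) (f.comm i j)

/-- A cycle relative to `U ∪ B` is represented by a chain in `V`, if `U`, `V` is an open cover. -/
lemma exists_subChains_rep {U V B : Set X} (hU : IsOpen U) (hV : IsOpen V)
    (hUV : U ∪ V = Set.univ) {z : (S R X).X n}
    (hz : ((S R X).d n (n - 1)).hom z ∈ supChains R U B (n - 1)) :
    ∃ v ∈ subChains R V n, ∃ y : (S R X).X (n + 1),
      z - v - ((S R X).d (n + 1) n).hom y ∈ supChains R U B n := by
  cases n with
  | zero =>
    -- A 0-simplex is a point, so it lies in `U` or in `V` without subdivision.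
    have hz' : z ∈ supChains R U V 0 := by
      refine (?_ : (⊤ : Submodule R _) ≤ supChains R U V 0) (Submodule.mem_top (x := z))
      rw [← (chainBasis R X 0).span_eq, Submodule.span_le]
      rintro _ ⟨σ, rfl⟩
      have hσ : ∀ t, σ t = σ (vert 0 0) := fun t => by
        rw [Subsingleton.elim t (vert 0 0)]
      rw [chainBasis_apply]
      have h : σ (vert 0 0) ∈ U ∪ V := hUV ▸ Set.mem_univ _
      rcases h with h | h
      · refine Submodule.mem_sup_left (gen_mem_spanOf ?_)
        rintro _ ⟨t, rfl⟩
        rwa [hσ]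
      · refine Submodule.mem_sup_right (gen_mem_spanOf ?_)
        rintro _ ⟨t, rfl⟩
        rwa [hσ]
    obtain ⟨u, hu, v, hv, rfl⟩ := Submodule.mem_sup.1 hz'
    refine ⟨v, hv, 0, ?_⟩
    rw [map_zero, sub_zero, add_sub_cancel_right]
    exact Submodule.mem_sup_left hu
  | succ n =>
    obtain ⟨m, hm⟩ := exists_sd_pow_mem hU hV hUV z
    obtain ⟨u, hu, v, hv, huv⟩ := Submodule.mem_sup.1 hm
    -- With `T` the iterated homotopy, `z - sd ^ m z = ∂Tz + T∂z`. The term `T∂z` stays in `U` or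
    -- `B` because the operators preserve supports; `B` itself need not be open.
    refine ⟨v, hv, sdTPow m (n + 1) z, ?_⟩
    have h := d_sdTPow m z
    rw [← huv] at h
    have h' : z - v - ((S R X).d (n + 2) (n + 1)).hom (sdTPow m (n + 1) z) =
        u + sdTPow m n (((S R X).d (n + 1) n).hom z) := by
      linear_combination (norm := module) (-1 : ℤ) • h
    rw [h']
    exact add_mem (Submodule.mem_sup_left hu) (sdTPow_mem_sup hz m)

/-- A chain in `V` which bounds relative to `U ∪ B` bounds relative to `U ∪ B` in `V`. -/
lemma exists_subChains_bound {U V B : Set X} (hU : IsOpen U) (hV : IsOpen V)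
    (hUV : U ∪ V = Set.univ) {v : (S R X).X n} (hv : v ∈ subChains R V n) {y : (S R X).X (n + 1)}
    (hy : v - ((S R X).d (n + 1) n).hom y ∈ supChains R U B n) :
    ∃ w ∈ subChains R V (n + 1), v - ((S R X).d (n + 1) n).hom w ∈ supChains R U B n := by
  obtain ⟨m, hm⟩ := exists_sd_pow_mem hU hV hUV y
  obtain ⟨u, hu, v1, hv1, huv⟩ := Submodule.mem_sup.1 hm
  set d := v - ((S R X).d (n + 1) n).hom y with hd
  -- The `V`-part of `sd ^ m y` alone is not enough. Applying `∂` to the homotopy formula for `y`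
  -- and inserting `∂y = v - d` leaves `∂Tv`, which is absorbed by adding the chain `T v` of `V`;
  -- all else lies in `U` or `B`.
  refine ⟨v1 + sdTPow m n v, add_mem hv1 (sdTPow_mem hv m), ?_⟩
  have h := congrArg ((S R X).d (n + 1) n).hom (d_sdTPow m y)
  have hdy : ((S R X).d (n + 1) n).hom y = v - d := by rw [hd]; abel
  rw [← huv, map_add, map_sub, map_add, d_d_apply, zero_add, hdy, map_sub, map_sub] at h
  have h' : v - ((S R X).d (n + 1) n).hom (v1 + sdTPow m n v) =
      d + ((S R X).d (n + 1) n).hom u - ((S R X).d (n + 1) n).hom (sdTPow m n d) := by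
    rw [map_add]
    linear_combination (norm := module) (-1 : ℤ) • h
  rw [h']
  exact sub_mem (add_mem hy (d_supChains (Submodule.mem_sup_left hu)))
    (d_supChains (sdTPow_mem_sup hy m))

end Subdivision

/-! ### Topology of the mapping cone -/

section Topology

/-- The added point is a discrete summand of `Z ⊔ pt`, so it imposes no condition. -/
lemma isOpen_collapse_iff {Z : Type u} [TopologicalSpace Z] {A : Set Z} {W : Set (Collapse Z A)} :
    IsOpen W ↔ IsOpen (Collapse.mk A ⁻¹' W) := by
  refine ⟨fun h => h.preimage (Collapse.continuous_mk A), fun h => ?_⟩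
  refine isOpen_coinduced.2 (isOpen_sum_iff.2 ⟨h, ?_⟩)
  exact isOpen_discrete _

lemma collapse_cases {Z : Type u} [TopologicalSpace Z] {A : Set Z} (z : Collapse Z A) :
    z = Collapse.base A ∨ ∃ c, z = Collapse.mk A c := by
  obtain ⟨c | c⟩ := z
  · exact Or.inr ⟨c, rfl⟩
  · exact Or.inl rfl

open Classical in
/-- The partial inverse of the quotient map `Z → Z / A`. -/
def Collapse.section? {Z : Type u} [TopologicalSpace Z] (A : Set Z) : Collapse Z A → Option Z :=
  Quot.lift (Sum.elim (fun z => if z ∈ A then none else some z) fun _ => none) (by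
    rintro _ _ ⟨a, ha⟩
    exact if_pos ha)

lemma Collapse.section?_mk {Z : Type u} [TopologicalSpace Z] {A : Set Z} {z : Z} (hz : z ∉ A) :
    Collapse.section? A (Collapse.mk A z) = some z :=
  if_neg hz

lemma Collapse.section?_base {Z : Type u} [TopologicalSpace Z] (A : Set Z) :
    Collapse.section? A (Collapse.base A) = none := rfl

lemma Collapse.mk_inj {Z : Type u} [TopologicalSpace Z] {A : Set Z} {z w : Z} (hz : z ∉ A)
    (h : Collapse.mk A z = Collapse.mk A w) : z = w := by
  by_cases hw : w ∈ A
  · have := congrArg (Collapse.section? A) h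
    rw [Collapse.section?_mk hz, Collapse.mk_eq_base hw, Collapse.section?_base] at this
    exact absurd this (by simp)
  · have := congrArg (Collapse.section? A) h
    rw [Collapse.section?_mk hz, Collapse.section?_mk hw] at this
    exact Option.some.inj this

variable {X Y : TopCat.{u}} (f : X ⟶ Y)

lemma cyl_cases (c : MappingCyl f) : (∃ p, c = cylInl f p) ∨ ∃ y, c = cylInr f y := by
  obtain ⟨p | y⟩ := c
  · exact Or.inl ⟨p, rfl⟩
  · exact Or.inr ⟨y, rfl⟩

lemma cylInl_one (x : X) : cylInl f (x, 1) = cylInr f (f x) := Quot.sound (CylRel.glue x)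

/-- A continuous map out of the mapping cylinder. -/
def cylDesc {T : Type*} [TopologicalSpace T] (a : C(X × unitInterval, T)) (b : C(Y, T))
    (h : ∀ x, a (x, 1) = b (f x)) : C(MappingCyl f, T) where
  toFun := Quot.lift (Sum.elim a b) (by rintro _ _ ⟨x⟩; exact h x)
  continuous_toFun := continuous_quot_lift _ (a.continuous.sumElim b.continuous)

lemma isOpen_cyl_iff {W : Set (MappingCyl f)} :
    IsOpen W ↔ IsOpen (cylInl f ⁻¹' W) ∧ IsOpen (cylInr f ⁻¹' W) := by
  refine ⟨fun h => ⟨h.preimage (cylInl f).continuous, h.preimage (cylInr f).continuous⟩,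
    fun h => isOpen_coinduced.2 (isOpen_sum_iff.2 h)⟩

/-- The height of a point of the mapping cylinder. -/
def cylHeight : C(MappingCyl f, unitInterval) :=
  cylDesc f ⟨Prod.snd, continuous_snd⟩ (ContinuousMap.const _ 1) fun _ => rfl

@[simp] lemma cylHeight_inl (p : X × unitInterval) : cylHeight f (cylInl f p) = p.2 := rfl

lemma mem_bottom_iff (c : MappingCyl f) :
    c ∈ cylInl f '' {p | p.2 = 0} ↔ cylHeight f c = 0 := by
  constructor
  · rintro ⟨p, hp, rfl⟩
    exact hp
  · intro h
    rcases cyl_cases f c with ⟨p, rfl⟩ | ⟨y, rfl⟩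
    · exact ⟨p, h, rfl⟩
    · exact absurd h one_ne_zero

/-- The quotient map from the mapping cylinder to the mapping cone. -/
abbrev cylToCone (c : MappingCyl f) : MappingConeSpace f := Collapse.mk _ c

lemma continuous_cylToCone : Continuous (cylToCone f) := Collapse.continuous_mk _

/-- A continuous map out of the mapping cone. -/
def coneDesc {T : Type*} [TopologicalSpace T] (a : C(MappingCyl f, T)) (t : T)
    (h : ∀ c, cylHeight f c = 0 → a c = t) : C(MappingConeSpace f, T) where
  toFun := Quot.lift (Sum.elim a fun _ => t) (by
    rintro _ _ ⟨c, hc⟩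
    exact h c ((mem_bottom_iff f c).1 hc))
  continuous_toFun := continuous_quot_lift _ (a.continuous.sumElim continuous_const)

/-- The height of a point of the mapping cone. -/
def coneHeight : C(MappingConeSpace f, unitInterval) :=
  coneDesc f (cylHeight f) 0 fun _ h => h

@[simp] lemma coneHeight_apex : coneHeight f (mappingConeApex f) = 0 := rfl

/-- The complement of the cone point. -/
def upper : Set (MappingConeSpace f) := {z | 0 < coneHeight f z}

/-- The complement of the base of the mapping cone. -/
def lower : Set (MappingConeSpace f) := {z | coneHeight f z < 1}

lemma isOpen_upper : IsOpen (upper f) := isOpen_lt continuous_const (coneHeight f).continuous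

lemma isOpen_lower : IsOpen (lower f) := isOpen_lt (coneHeight f).continuous continuous_const

lemma upper_union_lower : upper f ∪ lower f = Set.univ := by
  refine Set.eq_univ_of_forall fun z => ?_
  rcases eq_or_ne (coneHeight f z) 0 with h | h
  · exact Or.inr (by change coneHeight f z < 1; rw [h]; exact zero_lt_one)
  · exact Or.inl (unitInterval.pos_iff_ne_zero.2 h)

/-- The mapping cylinder without its bottom. -/
def OpenCyl : TopCat.{u} := TopCat.of {c : MappingCyl f // 0 < cylHeight f c}

/-- The embedding of the open mapping cylinder into the mapping cone. -/
def openCylToCone : OpenCyl f ⟶ MappingConeSpace f :=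
  TopCat.ofHom ⟨fun c => cylToCone f c.1, (continuous_cylToCone f).comp continuous_subtype_val⟩

lemma notMem_bottom {c : MappingCyl f} (h : 0 < cylHeight f c) :
    c ∉ cylInl f '' {p | p.2 = 0} := by
  rw [mem_bottom_iff]
  exact h.ne'

/-- Above the bottom nothing is collapsed, so a set there is the full preimage of its image. -/
lemma isOpenEmbedding_openCylToCone : Topology.IsOpenEmbedding (openCylToCone f) := by
  refine .of_continuous_injective_isOpenMap (openCylToCone f).hom.continuous ?_ ?_
  · rintro ⟨c, hc⟩ ⟨c', hc'⟩ h
    exact Subtype.ext (Collapse.mk_inj (notMem_bottom f hc) h)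
  · intro W hW
    have ho : IsOpen {c : MappingCyl f | 0 < cylHeight f c} :=
      isOpen_lt continuous_const (cylHeight f).continuous
    have hW' := ho.isOpenEmbedding_subtypeVal.isOpenMap W hW
    refine isOpen_collapse_iff.2 ?_
    convert hW' using 1
    ext c
    constructor
    · rintro ⟨c', hc', h⟩
      exact ⟨c', hc', Collapse.mk_inj (notMem_bottom f c'.2) h⟩
    · rintro ⟨c', hc', rfl⟩
      exact ⟨c', hc', rfl⟩

lemma range_openCylToCone : Set.range (openCylToCone f) = upper f := by
  ext z
  constructor
  · rintro ⟨c, rfl⟩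
    exact c.2
  · intro hz
    rcases collapse_cases z with rfl | ⟨c, rfl⟩
    · exact absurd hz (lt_irrefl (0 : unitInterval))
    · exact ⟨⟨c, hz⟩, rfl⟩

/-- The inclusion of `Y` into the open mapping cylinder. -/
def baseToOpenCyl : Y ⟶ OpenCyl f :=
  TopCat.ofHom ⟨fun y => ⟨cylInr f y, zero_lt_one (α := unitInterval)⟩,
    (cylInr f).continuous.subtype_mk _⟩

lemma baseToOpenCyl_comp : baseToOpenCyl f ≫ openCylToCone f = mapI f := rfl

/-- The retraction of the open mapping cylinder onto `Y`. -/
def openCylRetract : OpenCyl f ⟶ Y :=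
  TopCat.ofHom ((cylDesc f (⟨fun p => f p.1, by fun_prop⟩ : C(X × unitInterval, Y))
    (ContinuousMap.id _) fun _ => rfl).comp ⟨Subtype.val, continuous_subtype_val⟩)

/-- Pushing the mapping cylinder upwards, as a map into the space of paths. -/
def cylPush : C(MappingCyl f, C(unitInterval, MappingCyl f)) :=
  -- Curried into the path space, the homotopy descends by the universal property of the quotient;
  -- the product of the quotient map with the interval need not be examined.
  cylDesc f
    (ContinuousMap.curry ⟨fun q : (X × unitInterval) × unitInterval =>
      cylInl f (q.1.1, q.1.2 ⊔ q.2), by fun_prop⟩)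
    (ContinuousMap.curry ⟨fun q : Y × unitInterval => cylInr f q.1, by fun_prop⟩)
    fun x => ContinuousMap.ext fun s => by
      change cylInl f (x, 1 ⊔ s) = cylInr f (f x)
      rw [sup_of_le_left unitInterval.le_one', cylInl_one]

lemma cylPush_inl (p : X × unitInterval) (s : unitInterval) :
    cylPush f (cylInl f p) s = cylInl f (p.1, p.2 ⊔ s) := rfl

lemma cylHeight_push (c : MappingCyl f) (s : unitInterval) :
    cylHeight f c ≤ cylHeight f (cylPush f c s) := by
  rcases cyl_cases f c with ⟨p, rfl⟩ | ⟨y, rfl⟩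
  · exact le_sup_left
  · exact le_rfl

/-- The deformation retraction of the open mapping cylinder onto `Y`. -/
def openCylHomotopy : TopCat.Homotopy (𝟙 (OpenCyl f)) (openCylRetract f ≫ baseToOpenCyl f) where
  toFun q := ⟨cylPush f q.2.1 q.1, q.2.2.trans_le (cylHeight_push f _ _)⟩
  continuous_toFun := by
    refine Continuous.subtype_mk ?_ _
    exact (ContinuousEval.continuous_eval (F := C(unitInterval, MappingCyl f))).comp
      (((cylPush f).continuous.comp (continuous_subtype_val.comp continuous_snd)).prodMk
        continuous_fst)
  map_zero_left := by
    rintro ⟨c, hc⟩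
    refine Subtype.ext ?_
    change cylPush f c 0 = c
    rcases cyl_cases f c with ⟨p, rfl⟩ | ⟨y, rfl⟩
    · rw [cylPush_inl, sup_of_le_left unitInterval.nonneg']
    · rfl
  map_one_left := by
    rintro ⟨c, hc⟩
    refine Subtype.ext ?_
    rcases cyl_cases f c with ⟨p, rfl⟩ | ⟨y, rfl⟩
    · change cylInl f (p.1, p.2 ⊔ 1) = cylInr f (f p.1)
      rw [sup_of_le_right unitInterval.le_one', cylInl_one]
    · rfl

/-! ### The comparison with the mapping cone of the identity -/

/-- The map of mapping cylinders `Cyl_id → Cyl_f`. -/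
def cylCompare : C(MappingCyl (𝟙 X), MappingCyl f) :=
  cylDesc (𝟙 X) (cylInl f) ((cylInr f).comp f.hom) fun x => cylInl_one f x

lemma cylHeight_compare (c : MappingCyl (𝟙 X)) :
    cylHeight f (cylCompare f c) = cylHeight (𝟙 X) c := by
  rcases cyl_cases _ c with ⟨p, rfl⟩ | ⟨y, rfl⟩ <;> rfl

/-- The map of mapping cones `Cone_id → Cone_f`. -/
def coneCompare : MappingConeSpace (𝟙 X) ⟶ MappingConeSpace f :=
  TopCat.ofHom (coneDesc (𝟙 X)
    (⟨fun c => cylToCone f (cylCompare f c),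
      (continuous_cylToCone f).comp (cylCompare f).continuous⟩ :
        C(MappingCyl (𝟙 X), MappingConeSpace f)) (mappingConeApex f) fun c hc =>
      Collapse.mk_eq_base ((mem_bottom_iff f _).2 (by rw [cylHeight_compare, hc])))

lemma coneHeight_compare (z : MappingConeSpace (𝟙 X)) :
    coneHeight f (coneCompare f z) = coneHeight (𝟙 X) z := by
  rcases collapse_cases z with rfl | ⟨c, rfl⟩
  · rfl
  · exact cylHeight_compare f c

lemma mapI_compare : mapI (𝟙 X) ≫ coneCompare f = f ≫ mapI f := rfl

lemma mapJ_compare : mapJ (𝟙 X) ≫ coneCompare f = mapJ f := by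
  refine ConcreteCategory.hom_ext _ _ fun z => ?_
  rcases collapse_cases z with rfl | ⟨p, rfl⟩ <;> rfl

lemma apexInclusion_compare : apexInclusion (𝟙 X) ≫ coneCompare f = apexInclusion f := rfl

lemma coneHeight_eq_zero {z : MappingConeSpace f} (h : coneHeight f z = 0) :
    z = mappingConeApex f := by
  rcases collapse_cases z with rfl | ⟨c, rfl⟩
  · rfl
  · exact Collapse.mk_eq_base ((mem_bottom_iff f c).2 h)

/-- The map of open mapping cylinders. -/
def openCylCompare : OpenCyl (𝟙 X) ⟶ OpenCyl f :=
  TopCat.ofHom ⟨fun c => ⟨cylCompare f c.1, c.2.trans_eq (cylHeight_compare f c.1).symm⟩,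
    ((cylCompare f).continuous.comp continuous_subtype_val).subtype_mk _⟩

lemma openCylToCone_compare :
    openCylToCone (𝟙 X) ≫ coneCompare f = openCylCompare f ≫ openCylToCone f := rfl

lemma lower_cases {z : MappingConeSpace f} (h : z ∈ lower f) :
    z = mappingConeApex f ∨ ∃ p : X × unitInterval, p.2 ≠ 0 ∧ p.2 ≠ 1 ∧
      z = cylToCone f (cylInl f p) := by
  rcases collapse_cases z with rfl | ⟨c, rfl⟩
  · exact Or.inl rfl
  · rcases cyl_cases f c with ⟨p, rfl⟩ | ⟨y, rfl⟩
    · by_cases hp : p.2 = 0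
      · exact Or.inl (Collapse.mk_eq_base ((mem_bottom_iff f _).2 hp))
      · exact Or.inr ⟨p, hp, ne_of_lt (show p.2 < 1 from h), rfl⟩
    · exact absurd h (lt_irrefl (1 : unitInterval))

/-- Away from its top the cylinder is a product. -/
def cylSection? : MappingCyl f → Option (X × unitInterval) :=
  open Classical in
  Quot.lift (Sum.elim (fun p => if p.2 = 1 then none else some p) fun _ => none) (by
    rintro _ _ ⟨x⟩
    exact if_pos rfl)

lemma cylInl_inj {p q : X × unitInterval} (hp : p.2 ≠ 1) (h : cylInl f p = cylInl f q) :
    p = q := by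
  have hq : q.2 ≠ 1 := by
    have := congrArg (cylHeight f) h
    rw [cylHeight_inl, cylHeight_inl] at this
    rwa [← this]
  have h1 : ∀ r : X × unitInterval, r.2 ≠ 1 → cylSection? f (cylInl f r) = some r :=
    fun r hr => if_neg hr
  have := congrArg (cylSection? f) h
  rw [h1 p hp, h1 q hq] at this
  exact Option.some.inj this

/-- Replacing the identity by `f` makes new identifications only at height one. -/
lemma coneCompare_injOn : Set.InjOn (coneCompare f) (lower (𝟙 X)) := by
  intro z hz w hw h
  have hh : coneHeight (𝟙 X) z = coneHeight (𝟙 X) w := by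
    rw [← coneHeight_compare f, ← coneHeight_compare f, h]
  rcases lower_cases _ hz with rfl | ⟨p, hp0, hp1, rfl⟩
  · exact (coneHeight_eq_zero _ (hh.symm.trans (coneHeight_apex _))).symm
  · rcases lower_cases _ hw with rfl | ⟨q, hq0, hq1, rfl⟩
    · exact absurd hh hp0
    · have h1 : cylInl f p = cylInl f q :=
        Collapse.mk_inj (notMem_bottom f (unitInterval.pos_iff_ne_zero.2 hp0)) h
      rw [cylInl_inj f hp1 h1]

lemma coneCompare_surjOn {z : MappingConeSpace f} (hz : z ∈ lower f) :
    ∃ w ∈ lower (𝟙 X), coneCompare f w = z := by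
  rcases lower_cases _ hz with rfl | ⟨p, hp0, hp1, rfl⟩
  · exact ⟨mappingConeApex _, zero_lt_one (α := unitInterval), rfl⟩
  · exact ⟨cylToCone _ (cylInl _ p), lt_of_le_of_ne unitInterval.le_one' hp1, rfl⟩

/-- The image of an open `W` has the same preimage in `X × I` as `W`, by injectivity below height
one, and an empty preimage in `Y`, which lies at height one. -/
lemma isOpenEmbedding_compare :
    Topology.IsOpenEmbedding fun z : lower (𝟙 X) => coneCompare f z.1 := by
  refine .of_continuous_injective_isOpenMap
    ((coneCompare f).hom.continuous.comp continuous_subtype_val)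
    (fun z w h => Subtype.ext (coneCompare_injOn f z.2 w.2 h)) fun W hW => ?_
  have hW' := (isOpen_lower (𝟙 X)).isOpenEmbedding_subtypeVal.isOpenMap W hW
  replace hW' := (isOpen_cyl_iff _).1 (isOpen_collapse_iff.1 hW')
  refine isOpen_collapse_iff.2 ((isOpen_cyl_iff _).2 ?_)
  constructor
  · convert hW'.1 using 1
    ext p
    constructor
    · rintro ⟨z, hz, h⟩
      refine ⟨z, hz, ?_⟩
      refine coneCompare_injOn f z.2 ?_ h
      have h1 := congrArg (coneHeight f) h
      rw [coneHeight_compare] at h1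
      change p.2 < 1
      exact lt_of_eq_of_lt h1.symm z.2
    · rintro ⟨z, hz, h⟩
      exact ⟨z, hz, congrArg (coneCompare f) h⟩
  · convert isOpen_empty using 1
    ext y
    refine iff_of_false ?_ id
    rintro ⟨z, hz, h⟩
    have h1 := congrArg (coneHeight f) h
    rw [coneHeight_compare] at h1
    exact absurd h1 (ne_of_lt z.2)

/-- Maps into the lower part of `Cone_f` lift to `Cone_id`. -/
lemma exists_lift_compare {T : Type*} [TopologicalSpace T] (σ : C(T, MappingConeSpace f))
    (h : Set.range σ ⊆ lower f) : ∃ τ : C(T, MappingConeSpace (𝟙 X)),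
      Set.range τ ⊆ lower (𝟙 X) ∧ (coneCompare f).hom.comp τ = σ := by
  choose g hg hg' using fun t => coneCompare_surjOn f (h ⟨t, rfl⟩)
  have hc : Continuous fun t => (⟨g t, hg t⟩ : lower (𝟙 X)) := by
    rw [(isOpenEmbedding_compare f).continuous_iff]
    convert σ.continuous using 1
    exact funext hg'
  refine ⟨⟨g, continuous_subtype_val.comp hc⟩, ?_, ContinuousMap.ext hg'⟩
  rintro _ ⟨t, rfl⟩
  exact hg t

/-! ### The mapping cone of the identity is contractible -/

/-- The contraction of the mapping cone of the identity, as a map into the space of paths. -/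
def coneShrink : C(MappingConeSpace (𝟙 X), C(unitInterval, MappingConeSpace (𝟙 X))) :=
  coneDesc (𝟙 X) (cylDesc (𝟙 X)
    (ContinuousMap.curry ⟨fun q : (X × unitInterval) × unitInterval =>
      cylToCone _ (cylInl (𝟙 X) (q.1.1, q.1.2 * unitInterval.symm q.2)),
      (continuous_cylToCone _).comp (by fun_prop)⟩)
    -- A point of the added copy of `X` moves down its own ray. This uses that the gluing map is the
    -- identity: each point of the top determines a ray.
    (ContinuousMap.curry ⟨fun q : X × unitInterval =>
      cylToCone _ (cylInl (𝟙 X) (q.1, unitInterval.symm q.2)),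
      (continuous_cylToCone _).comp (by fun_prop)⟩)
    fun x => ContinuousMap.ext fun s => by
      change cylToCone _ (cylInl (𝟙 X) (x, 1 * unitInterval.symm s)) =
        cylToCone _ (cylInl (𝟙 X) (x, unitInterval.symm s))
      rw [one_mul])
    (ContinuousMap.const _ (mappingConeApex _)) fun c hc => by
      rcases cyl_cases _ c with ⟨p, rfl⟩ | ⟨y, rfl⟩
      · refine ContinuousMap.ext fun s => Collapse.mk_eq_base ((mem_bottom_iff _ _).2 ?_)
        change p.2 * unitInterval.symm s = 0
        rw [show p.2 = 0 from hc, zero_mul]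
      · exact absurd hc one_ne_zero

/-- The contraction of the mapping cone of the identity to its cone point. -/
def coneContraction : TopCat.Homotopy (𝟙 (MappingConeSpace (𝟙 X)))
    (TopCat.ofHom (ContinuousMap.const _ PUnit.unit) ≫ apexInclusion (𝟙 X)) where
  toFun q := coneShrink q.2 q.1
  continuous_toFun :=
    (ContinuousEval.continuous_eval (F := C(unitInterval, MappingConeSpace (𝟙 X)))).comp
      ((coneShrink.continuous.comp continuous_snd).prodMk continuous_fst)
  map_zero_left z := by
    change coneShrink z 0 = z
    rcases collapse_cases z with rfl | ⟨c, rfl⟩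
    · rfl
    · rcases cyl_cases _ c with ⟨p, rfl⟩ | ⟨y, rfl⟩
      · change cylToCone _ (cylInl (𝟙 X) (p.1, p.2 * unitInterval.symm 0)) = _
        rw [unitInterval.symm_zero, mul_one]
      · change cylToCone _ (cylInl (𝟙 X) (y, unitInterval.symm 0)) = _
        rw [unitInterval.symm_zero, cylInl_one]
        rfl
  map_one_left z := by
    change coneShrink z 1 = mappingConeApex _
    rcases collapse_cases z with rfl | ⟨c, rfl⟩
    · rfl
    · rcases cyl_cases _ c with ⟨p, rfl⟩ | ⟨y, rfl⟩
      · refine Collapse.mk_eq_base ((mem_bottom_iff _ _).2 ?_)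
        change p.2 * unitInterval.symm 1 = 0
        rw [unitInterval.symm_one, mul_zero]
      · refine Collapse.mk_eq_base ((mem_bottom_iff _ _).2 ?_)
        exact unitInterval.symm_one

end Topology

/-! ### The chain map property of `l` -/

section AlgCone

variable {R : Type u} [CommRing R] {A B : ChainComplex (ModuleCat.{u} R) ℕ} (g : A ⟶ B)

lemma algCone_d (n : ℕ) : (algCone g).d (n + 1) n = algConeD g n :=
  ChainComplex.of_d (algConeX A B) (algConeD g) n

lemma algCone_d_one_zero (x : A.X 0) (y : B.X 1) :
    ((algCone g).d 1 0).hom (show (algCone g).X 1 from (x, y)) =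
      (g.f 0).hom x - (B.d 1 0).hom y := by
  rw [algCone_d]
  rfl

lemma algCone_d_succ (n : ℕ) (x : A.X (n + 1)) (y : B.X (n + 2)) :
    ((algCone g).d (n + 2) (n + 1)).hom (show (algCone g).X (n + 2) from (x, y)) =
      (show (algCone g).X (n + 1) from
        ((A.d (n + 1) n).hom x, (g.f (n + 1)).hom x - (B.d (n + 2) (n + 1)).hom y)) := by
  rw [algCone_d]
  rfl

end AlgCone

/-! ### Faces of coned simplices and the sign identity for `l`. -/

section ChainMap

variable (R : Type u) [CommRing R] {X Y : TopCat.{u}} (f : X ⟶ Y) {n : ℕ}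

/-- In the coordinates of `joinMap`, the face opposite the vertex 0 is the top of the prism, while
the other faces are prisms over faces (`faceMap_succ_joinMap`). -/
lemma faceMap_zero_eq (t : Simp n) : faceMap n 0 t = joinMap n (t, 1) := by
  refine Subtype.ext (funext fun i => ?_)
  refine Fin.cases ?_ (fun i => ?_) i
  · rw [faceMap_apply_self, joinMap_zero]
    simp
  · have := faceMap_apply_succAbove 0 t i
    rw [Fin.succAbove_zero] at this
    rw [this, joinMap_succ]
    simp

lemma faceMap_succ_joinMap (i : Fin (n + 2)) (p : Simp n × unitInterval) :
    faceMap (n + 1) i.succ (joinMap n p) = joinMap (n + 1) (faceMap n i p.1, p.2) := by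
  refine Subtype.ext (funext fun j => ?_)
  refine Fin.succAboveCases i.succ ?_ (fun j => ?_) j
  · rw [faceMap_apply_self, joinMap_succ, faceMap_apply_self, mul_zero]
  · rw [faceMap_apply_succAbove]
    refine Fin.cases ?_ (fun j => ?_) j
    · rw [Fin.succ_succAbove_zero, joinMap_zero, joinMap_zero]
    · rw [Fin.succ_succAbove_succ, joinMap_succ, joinMap_succ, faceMap_apply_succAbove]

/-- The inclusion of `X` as the base of its cone. -/
def topMap (X : TopCat.{u}) : X ⟶ ConeSpace X :=
  TopCat.ofHom ⟨fun x => coneMk X (x, 1), (coneMk X).continuous.comp (by fun_prop)⟩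

lemma topMap_comp : topMap X ≫ mapJ f = f ≫ mapI f := by
  refine ConcreteCategory.hom_ext _ _ fun x => ?_
  exact congrArg (cylToCone f) (cylInl_one f x)

lemma coneMap_comp_faceMap_zero (σ : C(Simp n, X)) :
    (coneMap σ).comp (faceMap n 0) = (topMap X).hom.comp σ := by
  refine ContinuousMap.ext fun t => ?_
  change coneFun σ (faceMap n 0 t) = _
  rw [faceMap_zero_eq, coneFun_joinMap]
  rfl

lemma coneMap_comp_faceMap_succ (σ : C(Simp (n + 1), X)) (i : Fin (n + 2)) :
    (coneMap σ).comp (faceMap (n + 1) i.succ) = coneMap (σ.comp (faceMap n i)) := by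
  refine ContinuousMap.ext fun t => ?_
  obtain ⟨p, rfl⟩ := surjective_joinMap t
  change coneFun σ (faceMap (n + 1) i.succ (joinMap n p)) =
    coneFun (σ.comp (faceMap n i)) (joinMap n p)
  rw [faceMap_succ_joinMap, coneFun_joinMap, coneFun_joinMap]
  rfl

lemma coneMap_comp_faceMap_one (σ : C(Simp 0, X)) :
    (coneMap σ).comp (faceMap 0 1) = ContinuousMap.const _ (coneApex X) := by
  refine ContinuousMap.ext fun t => dif_pos ?_
  have h := faceMap_apply_succAbove 1 t 0
  have ht : t.1 0 = 1 := stdSimplex.eq_one_of_unique (X := Fin 1) t 0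
  rw [ht] at h
  exact h

variable {R} in
-- Face 0 of the cone is the simplex in the base; face `i + 1` is the cone over face `i`, and the
-- index shift reverses its sign.
lemma d_coneOp_succ (x : (S R X).X (n + 1)) :
    ((S R (ConeSpace X)).d (n + 2) (n + 1)).hom ((coneOp R X (n + 1)).hom x) =
      ((pushforward R (topMap X)).f (n + 1)).hom x -
        (coneOp R X n).hom (((S R X).d (n + 1) n).hom x) := by
  have : ((S R (ConeSpace X)).d (n + 2) (n + 1)).hom ∘ₗ (coneOp R X (n + 1)).hom =
      ((pushforward R (topMap X)).f (n + 1)).hom -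
        (coneOp R X n).hom ∘ₗ ((S R X).d (n + 1) n).hom := chain_ext R fun σ => by
    rw [LinearMap.sub_apply, LinearMap.comp_apply, LinearMap.comp_apply, coneOp_gen, d_gen, d_gen,
      pushforward_gen, Fin.sum_univ_succ, map_sum, coneMap_comp_faceMap_zero, Fin.val_zero,
      pow_zero, one_smul, sub_eq_add_neg, ← Finset.sum_neg_distrib]
    congr 1
    refine Finset.sum_congr rfl fun i _ => ?_
    rw [coneMap_comp_faceMap_succ, map_smul, coneOp_gen, Fin.val_succ, pow_succ, mul_neg_one,
      neg_smul]
  exact LinearMap.congr_fun this x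

variable {R} in
-- The correction `w` records one cone point for each 0-simplex of `x`. It is the reason why the
-- identity in degree zero holds only modulo the chains of the cone point.
lemma d_coneOp_zero (x : (S R X).X 0) :
    ∃ w, ((pushforward R (mapJ f)).f 0).hom (((S R (ConeSpace X)).d 1 0).hom
      ((coneOp R X 0).hom x)) = ((pushforward R (mapI f)).f 0).hom
        (((pushforward R f).f 0).hom x) - ((pushforward R (apexInclusion f)).f 0).hom w := by
  refine ⟨chainLift R (fun _ => gen R (ContinuousMap.const _ PUnit.unit)) x, ?_⟩
  have : ((pushforward R (mapJ f)).f 0).hom ∘ₗ ((S R (ConeSpace X)).d 1 0).hom ∘ₗ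
      (coneOp R X 0).hom = ((pushforward R (mapI f)).f 0).hom ∘ₗ ((pushforward R f).f 0).hom -
        ((pushforward R (apexInclusion f)).f 0).hom ∘ₗ
        chainLift R (fun _ => gen R (ContinuousMap.const _ PUnit.unit)) := chain_ext R fun σ => by
    simp only [LinearMap.sub_apply, LinearMap.comp_apply]
    rw [coneOp_gen, d_gen, Fin.sum_univ_two, map_add, map_smul, map_smul, pushforward_gen,
      pushforward_gen, pushforward_gen, pushforward_gen, chainLift_gen, pushforward_gen,
      coneMap_comp_faceMap_zero, coneMap_comp_faceMap_one, ← ContinuousMap.comp_assoc,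
      ← ContinuousMap.comp_assoc, ← TopCat.hom_comp, ← TopCat.hom_comp, topMap_comp]
    simp only [Fin.val_zero, Fin.val_one, pow_zero, pow_one, one_smul, neg_smul]
    rw [sub_eq_add_neg]
    rfl
  exact LinearMap.congr_fun this x

lemma l_zero (y : (S R Y).X 0) :
    (l R f 0).hom (show (algCone (pushforward R f)).X 0 from y) =
      -((pushforward R (mapI f)).f 0).hom y := rfl

lemma l_succ (x : (S R X).X n) (y : (S R Y).X (n + 1)) :
    (l R f (n + 1)).hom (show (algCone (pushforward R f)).X (n + 1) from (x, y)) =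
      ((pushforward R (mapJ f)).f (n + 1)).hom ((coneOp R X n).hom x) -
        ((pushforward R (mapI f)).f (n + 1)).hom y := rfl

lemma pushforward_comp_apply {Z : TopCat.{u}} (g : Y ⟶ Z) (x : (S R X).X n) :
    ((pushforward R g).f n).hom (((pushforward R f).f n).hom x) =
      ((pushforward R (f ≫ g)).f n).hom x := by
  have : ((pushforward R g).f n).hom ∘ₗ ((pushforward R f).f n).hom =
      ((pushforward R (f ≫ g)).f n).hom := chain_ext R fun σ => by
    rw [LinearMap.comp_apply, pushforward_gen, pushforward_gen, pushforward_gen]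
    rfl
  exact LinearMap.congr_fun this x

lemma l_comp_d (hn : 1 ≤ n) :
    l R f (n + 1) ≫ (S R (MappingConeSpace f)).d (n + 1) n +
      (algCone (pushforward R f)).d (n + 1) n ≫ l R f n = 0 := by
  obtain ⟨n, rfl⟩ : ∃ m, n = m + 1 := ⟨n - 1, by omega⟩
  refine ModuleCat.hom_ext (LinearMap.ext ?_)
  rintro ⟨x, y⟩
  change ((S R (MappingConeSpace f)).d (n + 2) (n + 1)).hom ((l R f (n + 2)).hom
    (show (algCone (pushforward R f)).X (n + 2) from (x, y))) +
    (l R f (n + 1)).hom (((algCone (pushforward R f)).d (n + 2) (n + 1)).hom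
      (show (algCone (pushforward R f)).X (n + 2) from (x, y))) = 0
  rw [algCone_d_succ, l_succ, l_succ, map_sub, hom_comm_apply, hom_comm_apply, d_coneOp_succ,
    map_sub, map_sub, pushforward_comp_apply, pushforward_comp_apply, topMap_comp]
  abel

lemma toRel_apex (w : (S R (TopCat.of PUnit.{u + 1})).X n) :
    ((toRel R f).f n).hom (((pushforward R (apexInclusion f)).f n).hom w) = 0 := by
  have h : pushforward R (apexInclusion f) ≫ toRel R f = 0 := cokernel.condition _
  exact congrArg (fun g : S R (TopCat.of PUnit.{u + 1}) ⟶ relChains R f => (g.f n).hom w) h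

lemma l_toRel_comp_d (n : ℕ) :
    (l R f (n + 1) ≫ (toRel R f).f (n + 1)) ≫ (relChains R f).d (n + 1) n +
      (algCone (pushforward R f)).d (n + 1) n ≫ (l R f n ≫ (toRel R f).f n) = 0 := by
  have h : (l R f (n + 1) ≫ (toRel R f).f (n + 1)) ≫ (relChains R f).d (n + 1) n +
      (algCone (pushforward R f)).d (n + 1) n ≫ (l R f n ≫ (toRel R f).f n) =
      (l R f (n + 1) ≫ (S R (MappingConeSpace f)).d (n + 1) n +
        (algCone (pushforward R f)).d (n + 1) n ≫ l R f n) ≫ (toRel R f).f n := by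
    rw [Preadditive.add_comp, Category.assoc, Category.assoc, Category.assoc,
      HomologicalComplex.Hom.comm]
  rw [h]
  cases n with
  | succ n => rw [l_comp_d R f (by omega), zero_comp]
  | zero =>
    refine ModuleCat.hom_ext (LinearMap.ext ?_)
    rintro ⟨x, y⟩
    change ((toRel R f).f 0).hom (((S R (MappingConeSpace f)).d 1 0).hom ((l R f 1).hom
      (show (algCone (pushforward R f)).X 1 from (x, y))) +
      (l R f 0).hom (((algCone (pushforward R f)).d 1 0).hom
        (show (algCone (pushforward R f)).X 1 from (x, y)))) = 0
    obtain ⟨w, hw⟩ := d_coneOp_zero f x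
    rw [algCone_d_one_zero, l_succ, map_sub, hom_comm_apply, hom_comm_apply, hw]
    have h0 := l_zero R f (((pushforward R f).f 0).hom x - ((S R Y).d 1 0).hom y)
    rw [← toRel_apex R f (-w)]
    refine congrArg _ ((congrArg₂ (· + ·) rfl h0).trans ?_)
    rw [map_sub, map_neg]
    abel

/-- The chain map `L : Cone_•(f_*) → S_•(Cone_f, *)`. -/
def mapL : algCone (pushforward R f) ⟶ relChains R f :=
  ChainComplex.ofHom (fun n => (-1 : ℤ) ^ n • (l R f n ≫ (toRel R f).f n)) fun n => by
    rw [Preadditive.zsmul_comp, Preadditive.comp_zsmul, eq_neg_of_add_eq_zero_left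
      (l_toRel_comp_d R f n), pow_succ, mul_neg_one, neg_smul, smul_neg, neg_neg]

lemma mapL_f (n : ℕ) : (mapL R f).f n = (-1 : ℤ) ^ n • (l R f n ≫ (toRel R f).f n) := rfl

end ChainMap

/-! ### Homological algebra with elements -/

section Elements

variable {R : Type u} [CommRing R] {K L : ChainComplex (ModuleCat.{u} R) ℕ}

lemma down_next (n : ℕ) : (ComplexShape.down ℕ).next n = n - 1 := by
  cases n with
  | zero => exact ChainComplex.next_nat_zero
  | succ n => exact ChainComplex.next_nat_succ n

/-- The fibre product of `h` and `g` serves as refinement; pointwise solvability makes its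
projection to `A` surjective, so no linear choice of solutions is needed. -/
lemma exists_refinement {A M N : ModuleCat.{u} R} (h : A ⟶ N) (g : M ⟶ N)
    (H : ∀ a, ∃ m, g.hom m = h.hom a) :
    ∃ (A' : ModuleCat.{u} R) (π : A' ⟶ A) (_ : Epi π) (x : A' ⟶ M), π ≫ h = x ≫ g := by
  let E : Submodule R (A × M) :=
    LinearMap.eqLocus (h.hom ∘ₗ LinearMap.fst R A M) (g.hom ∘ₗ LinearMap.snd R A M)
  refine ⟨ModuleCat.of R E, ModuleCat.ofHom (LinearMap.fst R A M ∘ₗ E.subtype), ?_,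
    ModuleCat.ofHom (LinearMap.snd R A M ∘ₗ E.subtype), ?_⟩
  · rw [ModuleCat.epi_iff_surjective]
    intro a
    obtain ⟨m, hm⟩ := H a
    exact ⟨⟨(a, m), hm.symm⟩, rfl⟩
  · exact ModuleCat.hom_ext (LinearMap.ext fun x => x.2)

/-- For `n = 0` the truncated `n - 1` is again 0, and `d 0 0` vanishes, so every chain of degree
zero counts as a cycle. -/
lemma quasiIso_of_elements (φ : K ⟶ L)
    (hinj : ∀ (n : ℕ) (k : K.X n), (K.d n (n - 1)).hom k = 0 → ∀ l : L.X (n + 1),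
      (φ.f n).hom k = (L.d (n + 1) n).hom l → ∃ k', (K.d (n + 1) n).hom k' = k)
    (hsurj : ∀ (n : ℕ) (l : L.X n), (L.d n (n - 1)).hom l = 0 → ∃ k : K.X n,
      (K.d n (n - 1)).hom k = 0 ∧ ∃ l', (φ.f n).hom k + (L.d (n + 1) n).hom l' = l) :
    QuasiIso φ := by
  rw [quasiIso_iff]
  intro n
  rw [quasiIsoAt_iff_isIso_homologyMap]
  have h1 : Mono (HomologicalComplex.homologyMap φ n) := by
    rw [HomologicalComplex.mono_homologyMap_iff_up_to_refinements φ (n + 1) n (n - 1)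
      (by simp) (down_next n)]
    intro A x hx y hy
    refine exists_refinement x (K.d (n + 1) n) fun a => ?_
    exact hinj n (x.hom a) (congrArg (fun g => g.hom a) hx) (y.hom a)
      (congrArg (fun g => g.hom a) hy)
  have h2 : Epi (HomologicalComplex.homologyMap φ n) := by
    rw [HomologicalComplex.epi_homologyMap_iff_up_to_refinements φ (n + 1) n (n - 1)
      (by simp) (down_next n)]
    intro A y hy
    let C := LinearMap.ker (K.d n (n - 1)).hom
    obtain ⟨A', π, hπ, x, hx⟩ := exists_refinement y
      (M := ModuleCat.of R (C × L.X (n + 1)))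
      (ModuleCat.ofHom ((φ.f n).hom ∘ₗ C.subtype ∘ₗ LinearMap.fst R C (L.X (n + 1)) +
        (L.d (n + 1) n).hom ∘ₗ LinearMap.snd R C (L.X (n + 1)))) fun a => by
        obtain ⟨k, hk, l', hl⟩ := hsurj n (y.hom a) (congrArg (fun g => g.hom a) hy)
        exact ⟨(⟨k, hk⟩, l'), hl⟩
    refine ⟨A', π, hπ, ModuleCat.ofHom (C.subtype ∘ₗ LinearMap.fst R C (L.X (n + 1)) ∘ₗ x.hom),
      ?_, ModuleCat.ofHom (LinearMap.snd R C (L.X (n + 1)) ∘ₗ x.hom), hx⟩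
    exact ModuleCat.hom_ext (LinearMap.ext fun a => (x.hom a).1.2)
  exact isIso_of_mono_of_epi _

lemma acyclic_of_elements
    (h : ∀ (n : ℕ) (k : K.X n), (K.d n (n - 1)).hom k = 0 → ∃ k', (K.d (n + 1) n).hom k' = k) :
    K.Acyclic := by
  intro n
  rw [K.exactAt_iff' (n + 1) n (n - 1) (by simp) (down_next n), ShortComplex.moduleCat_exact_iff]
  exact h n

lemma quasiIso_of_acyclic (φ : K ⟶ L) (hK : K.Acyclic) (hL : L.Acyclic) : QuasiIso φ := by
  rw [quasiIso_iff]
  exact fun n => (quasiIsoAt_iff_exactAt φ n (hK n)).2 (hL n)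

lemma homology_comp_apply {K L M : ChainComplex (ModuleCat.{u} R) ℕ} (φ : K ⟶ L) (ψ : L ⟶ M)
    (n : ℕ) (x : K.homology n) :
    (HomologicalComplex.homologyMap (φ ≫ ψ) n).hom x =
      (HomologicalComplex.homologyMap ψ n).hom ((HomologicalComplex.homologyMap φ n).hom x) := by
  rw [HomologicalComplex.homologyMap_comp]
  rfl

lemma homology_bijective (φ : K ⟶ L) [QuasiIso φ] (n : ℕ) :
    Function.Bijective (HomologicalComplex.homologyMap φ n).hom :=
  (ConcreteCategory.isIso_iff_bijective (HomologicalComplex.homologyMap φ n)).1 inferInstance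

/-- The five lemma for the middle terms of a map of short exact sequences of chain complexes. -/
lemma quasiIso_τ₂ {S₁ S₂ : ShortComplex (ChainComplex (ModuleCat.{u} R) ℕ)} (φ : S₁ ⟶ S₂)
    (hS₁ : S₁.ShortExact) (hS₂ : S₂.ShortExact) (h₁ : QuasiIso φ.τ₁) (h₃ : QuasiIso φ.τ₃) :
    QuasiIso φ.τ₂ := by
  rw [quasiIso_iff]
  intro n
  rw [quasiIsoAt_iff_isIso_homologyMap]
  refine (ConcreteCategory.isIso_iff_bijective _).2 ⟨?_, ?_⟩
  · refine (injective_iff_map_eq_zero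
      (HomologicalComplex.homologyMap φ.τ₂ n).hom).2 fun x hx => ?_
    have e1 := (hS₁.homology_exact₂ n)
    rw [ShortComplex.moduleCat_exact_iff] at e1
    obtain ⟨y, rfl⟩ := e1 x (by
      refine (homology_bijective φ.τ₃ n).1 ?_
      change (HomologicalComplex.homologyMap φ.τ₃ n).hom
        ((HomologicalComplex.homologyMap S₁.g n).hom x) = _
      rw [← homology_comp_apply, ← φ.comm₂₃, homology_comp_apply, hx, map_zero, map_zero])
    change (HomologicalComplex.homologyMap φ.τ₂ n).hom
      ((HomologicalComplex.homologyMap S₁.f n).hom y) = 0 at hx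
    change (HomologicalComplex.homologyMap S₁.f n).hom y = 0
    rw [← homology_comp_apply, ← φ.comm₁₂, homology_comp_apply] at hx
    have e2 := hS₂.homology_exact₁ (n + 1) n (by simp)
    rw [ShortComplex.moduleCat_exact_iff] at e2
    obtain ⟨w, hw⟩ := e2 _ hx
    obtain ⟨w', rfl⟩ := (homology_bijective φ.τ₃ (n + 1)).2 w
    have nat := congrArg (fun g => g.hom w')
      (HomologicalComplex.HomologySequence.δ_naturality φ hS₁ hS₂ (n + 1) n (by simp))
    have hy : y = (hS₁.δ (n + 1) n (by simp)).hom w' :=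
      (homology_bijective φ.τ₁ n).1 (hw.symm.trans nat.symm)
    rw [hy]
    exact congrArg (fun g => g.hom w') (hS₁.δ_comp (n + 1) n (by simp))
  · intro y
    obtain ⟨w, hw⟩ := (homology_bijective φ.τ₃ n).2 ((HomologicalComplex.homologyMap S₂.g n).hom y)
    -- In positive degrees the obstruction is the connecting map. In degree zero there is none, and
    -- an epimorphism of complexes is onto on `H_0`.
    have hx : ∃ x, (HomologicalComplex.homologyMap S₁.g n).hom x = w := by
      cases n with
      | zero =>
        have := hS₁.epi_g
        have := HomologicalComplex.epi_homologyMap_of_epi_of_not_rel S₁.g 0 (by simp)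
        exact (ModuleCat.epi_iff_surjective _).1 this w
      | succ n =>
        have e1 := hS₁.homology_exact₃ (n + 1) n (by simp)
        rw [ShortComplex.moduleCat_exact_iff] at e1
        refine e1 w ((homology_bijective φ.τ₁ n).1 ?_)
        have nat := congrArg (fun g => g.hom w)
          (HomologicalComplex.HomologySequence.δ_naturality φ hS₁ hS₂ (n + 1) n (by simp))
        refine nat.trans ?_
        change (hS₂.δ (n + 1) n (by simp)).hom
          ((HomologicalComplex.homologyMap φ.τ₃ (n + 1)).hom w) = _
        rw [hw, map_zero]
        exact congrArg (fun g => g.hom y) (hS₂.comp_δ (n + 1) n (by simp))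
    obtain ⟨x, rfl⟩ := hx
    have e2 := hS₂.homology_exact₂ n
    rw [ShortComplex.moduleCat_exact_iff] at e2
    obtain ⟨z, hz⟩ := e2 (y - (HomologicalComplex.homologyMap φ.τ₂ n).hom x) (by
      change (HomologicalComplex.homologyMap S₂.g n).hom _ = 0
      rw [map_sub, ← homology_comp_apply, φ.comm₂₃, homology_comp_apply, hw, sub_self])
    obtain ⟨z', rfl⟩ := (homology_bijective φ.τ₁ n).2 z
    refine ⟨x + (HomologicalComplex.homologyMap S₁.f n).hom z', ?_⟩
    change (HomologicalComplex.homologyMap φ.τ₂ n).hom _ = y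
    rw [map_add, ← homology_comp_apply, ← φ.comm₁₂, homology_comp_apply]
    change (HomologicalComplex.homologyMap S₂.f n).hom _ = _ at hz
    rw [hz, add_sub_cancel]

lemma shortExact_of_elements (C : ShortComplex (ChainComplex (ModuleCat.{u} R) ℕ))
    (h₁ : ∀ n, Function.Injective (C.f.f n).hom)
    (h₂ : ∀ n y, (C.g.f n).hom y = 0 → ∃ x, (C.f.f n).hom x = y)
    (h₃ : ∀ n, Function.Surjective (C.g.f n).hom) : C.ShortExact :=
  HomologicalComplex.shortExact_of_degreewise_shortExact _ fun n =>
    { exact := (ShortComplex.moduleCat_exact_iff _).2 (h₂ n)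
      mono_f := (ModuleCat.mono_iff_injective _).2 (h₁ n)
      epi_g := (ModuleCat.epi_iff_surjective _).2 (h₃ n) }

lemma mono_of_injective (φ : K ⟶ L) (h : ∀ n, Function.Injective (φ.f n).hom) : Mono φ := by
  have (n : ℕ) : Mono (φ.f n) := (ModuleCat.mono_iff_injective _).2 (h n)
  exact HomologicalComplex.mono_of_mono_f φ this

lemma cokernel_π_surjective (φ : K ⟶ L) (n : ℕ) :
    Function.Surjective ((cokernel.π φ).f n).hom :=
  (ModuleCat.epi_iff_surjective _).1 inferInstance

lemma cokernel_π_eq_zero (φ : K ⟶ L) (n : ℕ) (y : L.X n)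
    (h : ((cokernel.π φ).f n).hom y = 0) : ∃ x, (φ.f n).hom x = y := by
  have e := (ShortComplex.exact_cokernel φ).map (HomologicalComplex.eval _ _ n)
  rw [ShortComplex.moduleCat_exact_iff] at e
  exact e y h

lemma comp_cokernel_π_apply (φ : K ⟶ L) (n : ℕ) (x : K.X n) :
    ((cokernel.π φ).f n).hom ((φ.f n).hom x) = 0 :=
  congrArg (fun g : K ⟶ cokernel φ => (g.f n).hom x) (cokernel.condition φ)

lemma shortExact_cokernel (φ : K ⟶ L) [Mono φ] :
    (ShortComplex.mk φ (cokernel.π φ) (cokernel.condition φ)).ShortExact where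
  exact := ShortComplex.exact_cokernel φ
  mono_f := ‹_›
  epi_g := inferInstanceAs (Epi (cokernel.π φ))

end Elements

/-! ### The algebraic mapping cone as an extension -/

section Extension

open scoped ZeroObject

variable {R : Type u} [CommRing R] {A B A' B' : ChainComplex (ModuleCat.{u} R) ℕ}

/-- The functoriality of the algebraic mapping cone. -/
def algConeMap (g : A ⟶ B) (g' : A' ⟶ B') (a : A ⟶ A') (b : B ⟶ B') (h : g ≫ b = a ≫ g') :
    algCone g ⟶ algCone g' :=
  ChainComplex.ofHom
    (fun n => match n with
      | 0 => b.f 0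
      | n + 1 => ModuleCat.ofHom ((a.f n).hom.prodMap (b.f (n + 1)).hom)) fun n => by
    have hh : ∀ (n : ℕ) (x : A.X n),
        (b.f n).hom ((g.f n).hom x) = (g'.f n).hom ((a.f n).hom x) := fun n x =>
      congrArg (fun t : A ⟶ B' => (t.f n).hom x) h
    rw [algCone_d, algCone_d]
    cases n with
    | zero =>
      refine ModuleCat.hom_ext (LinearMap.ext ?_)
      rintro ⟨x, y⟩
      change (g'.f 0).hom ((a.f 0).hom x) - (B'.d 1 0).hom ((b.f 1).hom y) =
        (b.f 0).hom ((g.f 0).hom x - (B.d 1 0).hom y)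
      rw [map_sub, hh, hom_comm_apply]
    | succ n =>
      refine ModuleCat.hom_ext (LinearMap.ext ?_)
      rintro ⟨x, y⟩
      refine Prod.ext ?_ ?_
      · exact hom_comm_apply a _ _ x
      · change (g'.f (n + 1)).hom ((a.f (n + 1)).hom x) -
          (B'.d (n + 2) (n + 1)).hom ((b.f (n + 2)).hom y) =
          (b.f (n + 1)).hom ((g.f (n + 1)).hom x - (B.d (n + 2) (n + 1)).hom y)
        rw [map_sub, hh, hom_comm_apply]

variable (g : A ⟶ B)

/-- The inclusion of the summand `B_n` in the algebraic mapping cone. -/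
def algConeInrX : ∀ n : ℕ, B.X n ⟶ (algCone g).X n
  | 0 => 𝟙 (B.X 0)
  | n + 1 => ModuleCat.ofHom (LinearMap.inr R (A.X n) (B.X (n + 1)))

/-- The cone carries `-∂` on its summand `B`, hence the alternating signs in `algConeInr`; they
cancel those of L in `algConeInr_mapL`. -/
lemma algConeInrX_d (n : ℕ) :
    algConeInrX g (n + 1) ≫ (algCone g).d (n + 1) n = -(B.d (n + 1) n ≫ algConeInrX g n) := by
  rw [algCone_d]
  cases n with
  | zero =>
    refine ModuleCat.hom_ext (LinearMap.ext fun y => ?_)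
    change (g.f 0).hom 0 - (B.d 1 0).hom y = -((B.d 1 0).hom y)
    rw [map_zero, zero_sub]
  | succ n =>
    refine ModuleCat.hom_ext (LinearMap.ext fun y => ?_)
    refine Prod.ext ?_ ?_
    · change (A.d (n + 1) n).hom 0 = -0
      rw [map_zero, neg_zero]
    · change (g.f (n + 1)).hom 0 - (B.d (n + 2) (n + 1)).hom y = -((B.d (n + 2) (n + 1)).hom y)
      rw [map_zero, zero_sub]

/-- The inclusion of `B` in the algebraic mapping cone. -/
def algConeInr : B ⟶ algCone g :=
  ChainComplex.ofHom (fun n => (-1 : ℤ) ^ n • algConeInrX g n) fun n => by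
    rw [Preadditive.zsmul_comp, algConeInrX_d, Preadditive.comp_zsmul, pow_succ, mul_neg_one,
      neg_smul, smul_neg, neg_neg]

lemma algConeInr_f (n : ℕ) : (algConeInr g).f n = (-1 : ℤ) ^ n • algConeInrX g n := rfl

lemma zsmul_neg_one_pow_mul_self {M : Type*} [AddCommGroup M] (n : ℕ) (x : M) :
    (-1 : ℤ) ^ n • (-1 : ℤ) ^ n • x = x := by
  rw [smul_smul, ← mul_pow, neg_one_mul, neg_neg, one_pow, one_smul]

/-- The projection of the algebraic mapping cone to the shift of `A`. -/
def algConeProj : algCone g ⟶ algCone (0 : A ⟶ 0) :=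
  -- The shift of `A` is realised as the cone of `A → 0`, so that the projection is an instance of
  -- functoriality.
  algConeMap g 0 (𝟙 A) 0 (by rw [comp_zero, comp_zero])

lemma algConeInr_proj : algConeInr g ≫ algConeProj g = 0 := by
  refine HomologicalComplex.Hom.ext (funext fun n => ?_)
  rw [HomologicalComplex.comp_f, algConeInr_f, Preadditive.zsmul_comp]
  have h : algConeInrX g n ≫ (algConeProj g).f n = 0 := by
    cases n with
    | zero =>
      exact Category.id_comp (0 : B.X 0 ⟶ (0 : ChainComplex (ModuleCat.{u} R) ℕ).X 0)
    | succ n => exact ModuleCat.hom_ext (LinearMap.ext fun y => Prod.ext rfl rfl)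
  rw [h, smul_zero]
  rfl

lemma subsingleton_zero_X (n : ℕ) :
    Subsingleton ((0 : ChainComplex (ModuleCat.{u} R) ℕ).X n) :=
  ModuleCat.subsingleton_of_isZero
    ((HomologicalComplex.eval _ _ n).map_isZero (isZero_zero _))

lemma algCone_shortExact :
    (ShortComplex.mk (algConeInr g) (algConeProj g) (algConeInr_proj g)).ShortExact := by
  refine shortExact_of_elements _ (fun n => ?_) (fun n y hy => ?_) fun n => ?_
  · have h : Function.Injective (algConeInrX g n).hom := by
      cases n with
      | zero => exact Function.injective_id
      | succ n => exact LinearMap.inr_injective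
    intro x y hxy
    change (-1 : ℤ) ^ n • (algConeInrX g n).hom x = (-1 : ℤ) ^ n • (algConeInrX g n).hom y at hxy
    have := congrArg ((-1 : ℤ) ^ n • ·) hxy
    simp only [zsmul_neg_one_pow_mul_self] at this
    exact h this
  · have h : ∃ x, (algConeInrX g n).hom x = y := by
      cases n with
      | zero => exact ⟨y, rfl⟩
      | succ n =>
        obtain ⟨x, y⟩ := y
        have hx : x = 0 := congrArg Prod.fst hy
        subst hx
        exact ⟨y, rfl⟩
    obtain ⟨x, rfl⟩ := h
    refine ⟨(-1 : ℤ) ^ n • x, ?_⟩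
    change (-1 : ℤ) ^ n • (algConeInrX g n).hom ((-1 : ℤ) ^ n • x) = _
    rw [map_zsmul, zsmul_neg_one_pow_mul_self]
  · cases n with
    | zero => exact fun y => ⟨0, (subsingleton_zero_X (R := R) 0).elim _ _⟩
    | succ n =>
      rintro ⟨x, y⟩
      exact ⟨(x, 0), Prod.ext rfl ((subsingleton_zero_X (R := R) (n + 1)).elim _ _)⟩

/-- Given a cycle `(x, y)`, lift `y` to `z` along `g`. Then `g ∂z = ∂y = g x`, so `∂z = x` by
injectivity and `(z, 0)` bounds the cycle. -/
lemma algCone_acyclic (h : ∀ n, Function.Bijective (g.f n).hom) : (algCone g).Acyclic := by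
  refine acyclic_of_elements fun n k hk => ?_
  cases n with
  | zero =>
    obtain ⟨x, hx⟩ := (h 0).2 k
    refine ⟨(x, 0), ?_⟩
    rw [algCone_d_one_zero, map_zero, hx]
    exact sub_zero (G := B.X 0) k
  | succ n =>
    obtain ⟨x, y⟩ := k
    obtain ⟨z, rfl⟩ := (h (n + 1)).2 y
    refine ⟨(z, 0), ?_⟩
    rw [algCone_d_succ, map_zero, sub_zero]
    refine Prod.ext ((h n).1 ?_) rfl
    change (g.f n).hom ((A.d (n + 1) n).hom z) = (g.f n).hom x
    rw [← hom_comm_apply]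
    symm
    cases n with
    | zero =>
      rw [← sub_eq_zero]
      exact (algCone_d_one_zero g x _).symm.trans hk
    | succ n =>
      rw [← sub_eq_zero]
      exact congrArg Prod.snd ((algCone_d_succ g n x _).symm.trans hk)

end Extension

/-! ### Excision and the quasi-isomorphism -/

section Excision

variable (R : Type u) [CommRing R] {X Y : TopCat.{u}} (f : X ⟶ Y)

lemma pushforward_comp {Z : TopCat.{u}} (g : Y ⟶ Z) :
    pushforward R f ≫ pushforward R g = pushforward R (f ≫ g) :=
  HomologicalComplex.Hom.ext (funext fun n => chain_hom_ext' R fun σ => by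
    exact (pushforward_comp_apply R f g (gen R σ)))

lemma pushforward_id : pushforward R (𝟙 X) = 𝟙 (S R X) :=
  HomologicalComplex.Hom.ext (funext fun n => chain_hom_ext' R fun σ => by
    rw [pushforward_gen]
    rfl)

/-- Homotopic maps induce chain homotopic maps. -/
def pushforwardHomotopy {f g : X ⟶ Y} (H : TopCat.Homotopy f g) :
    Homotopy (pushforward R f) (pushforward R g) :=
  H.toSSet.chainComplexMap (ModuleCat.of R R)

lemma quasiIso_pushforward_of_homotopy (g : Y ⟶ X) (H₁ : TopCat.Homotopy (𝟙 X) (f ≫ g))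
    (H₂ : TopCat.Homotopy (𝟙 Y) (g ≫ f)) : QuasiIso (pushforward R f) :=
  HomotopyEquiv.quasiIso_hom
    { hom := pushforward R f
      inv := pushforward R g
      homotopyHomInvId := (Homotopy.ofEq (pushforward_comp R f g)).trans
        ((pushforwardHomotopy R H₁).symm.trans (Homotopy.ofEq (pushforward_id R)))
      homotopyInvHomId := (Homotopy.ofEq (pushforward_comp R g f)).trans
        ((pushforwardHomotopy R H₂).symm.trans (Homotopy.ofEq (pushforward_id R))) }

lemma quasiIso_baseToOpenCyl : QuasiIso (pushforward R (baseToOpenCyl f)) :=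
  quasiIso_pushforward_of_homotopy R _ (openCylRetract f)
    (ContinuousMap.Homotopy.refl _) (openCylHomotopy f)

variable {R}

lemma pushforward_mem {A : Set X} {B : Set Y} (h : ∀ x ∈ A, f x ∈ B) {n : ℕ} {z : (S R X).X n}
    (hz : z ∈ subChains R A n) : ((pushforward R f).f n).hom z ∈ subChains R B n := by
  refine map_mem_of_spanOf (fun σ hσ => ?_) hz
  rw [pushforward_gen]
  refine gen_mem_spanOf ?_
  rintro _ ⟨t, rfl⟩
  exact h _ (hσ ⟨t, rfl⟩)

lemma exists_pushforward_eq {A : Set X} {B : Set Y} {n : ℕ}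
    (h : ∀ σ : C(Simp n, Y), Set.range σ ⊆ B →
      ∃ τ : C(Simp n, X), Set.range τ ⊆ A ∧ f.hom.comp τ = σ)
    {z : (S R Y).X n} (hz : z ∈ subChains R B n) :
    ∃ w ∈ subChains R A n, ((pushforward R f).f n).hom w = z := by
  have hle : subChains R B n ≤ (subChains R A n).map ((pushforward R f).f n).hom := by
    refine Submodule.span_le.2 ?_
    rintro _ ⟨σ, hσ, rfl⟩
    obtain ⟨τ, hτ, rfl⟩ := h σ hσ
    exact ⟨gen R τ, gen_mem_spanOf hτ, pushforward_gen R f τ⟩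
  exact hle hz

lemma exists_openCyl_lift {n : ℕ} (σ : C(Simp n, MappingConeSpace f))
    (h : Set.range σ ⊆ upper f) : ∃ τ : C(Simp n, OpenCyl f),
      Set.range τ ⊆ Set.univ ∧ (openCylToCone f).hom.comp τ = σ := by
  have hlift : ∀ t, ∃ c, openCylToCone f c = σ t := fun t => by
    have := h ⟨t, rfl⟩
    rwa [← range_openCylToCone] at this
  choose g hg using hlift
  have hc : Continuous g := by
    rw [(isOpenEmbedding_openCylToCone f).continuous_iff]
    convert σ.continuous using 1
    exact funext hg
  exact ⟨⟨g, hc⟩, Set.subset_univ _, ContinuousMap.ext hg⟩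

lemma exists_apex_lift {n : ℕ} (σ : C(Simp n, MappingConeSpace f))
    (h : Set.range σ ⊆ {mappingConeApex f}) : ∃ τ : C(Simp n, TopCat.of PUnit.{u + 1}),
      Set.range τ ⊆ Set.univ ∧ (apexInclusion f).hom.comp τ = σ :=
  ⟨ContinuousMap.const _ PUnit.unit, Set.subset_univ _,
    ContinuousMap.ext fun t => (h ⟨t, rfl⟩).symm⟩

lemma mem_subChains_univ {n : ℕ} (z : (S R X).X n) : z ∈ subChains R Set.univ n :=
  mem_spanOf_iff.2 fun _ _ => Set.subset_univ _

lemma pushforward_openCyl_injective (n : ℕ) :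
    Function.Injective ((pushforward R (openCylToCone f)).f n).hom :=
  pushforward_injective fun _ _ h => ContinuousMap.ext fun t =>
    (isOpenEmbedding_openCylToCone f).injective (DFunLike.congr_fun h t)

lemma pushforward_apex_injective (n : ℕ) :
    Function.Injective ((pushforward R (apexInclusion f)).f n).hom :=
  pushforward_injective fun _ _ _ => ContinuousMap.ext fun _ => rfl

/-- The chains that are supported away from the cone point or in the cone point. -/
abbrev trivialChains (R : Type u) [CommRing R] (n : ℕ) :
    Submodule R ((S R (MappingConeSpace f)).X n) :=
  supChains R (upper f) {mappingConeApex f} n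

instance : Mono (pushforward R (apexInclusion f)) :=
  mono_of_injective _ (pushforward_apex_injective f)

variable (R) in
/-- The chains of the open mapping cylinder in the relative chains of the mapping cone. -/
def openCylToRel : S R (OpenCyl f) ⟶ relChains R f :=
  pushforward R (openCylToCone f) ≫ toRel R f

lemma openCylToRel_apply {n : ℕ} (z : (S R (OpenCyl f)).X n) : ((openCylToRel R f).f n).hom z =
    ((toRel R f).f n).hom (((pushforward R (openCylToCone f)).f n).hom z) := rfl

/-- No simplex lies both in the cone point and in its complement, so a chain supported in each of
them is zero. -/
lemma openCylToRel_injective (n : ℕ) : Function.Injective ((openCylToRel R f).f n).hom := by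
  rw [injective_iff_map_eq_zero]
  intro z hz
  rw [openCylToRel_apply] at hz
  obtain ⟨w, hw⟩ := cokernel_π_eq_zero _ n _ hz
  have h1 : ((pushforward R (openCylToCone f)).f n).hom z ∈ subChains R (upper f) n :=
    pushforward_mem (openCylToCone f) (A := Set.univ) (fun (c : OpenCyl f) _ => c.2) (mem_subChains_univ z)
  have h2 : ((pushforward R (openCylToCone f)).f n).hom z ∈
      subChains R {mappingConeApex f} n := by
    rw [← hw]
    exact pushforward_mem (apexInclusion f) (A := Set.univ) (fun _ _ => rfl) (mem_subChains_univ w)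
  refine pushforward_openCyl_injective f n ?_
  rw [map_zero, ← (chainBasis R _ n).repr.map_eq_zero_iff]
  ext σ
  by_contra hσ
  have a1 := mem_spanOf_iff.1 h1 σ hσ ⟨vert n 0, rfl⟩
  have a2 := mem_spanOf_iff.1 h2 σ hσ ⟨vert n 0, rfl⟩
  rw [Set.mem_singleton_iff] at a2
  rw [a2] at a1
  exact lt_irrefl (0 : unitInterval) a1

instance : Mono (openCylToRel R f) := mono_of_injective _ (openCylToRel_injective f)

variable (R) in
/-- The chains of the mapping cone relative to the cone point and to its complement. -/
abbrev localChains : ChainComplex (ModuleCat.{u} R) ℕ := cokernel (openCylToRel R f)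

variable (R) in
/-- The quotient map to the chains relative to the cone point and to its complement. -/
def toLocal : S R (MappingConeSpace f) ⟶ localChains R f :=
  toRel R f ≫ cokernel.π (openCylToRel R f)

lemma toLocal_surjective (n : ℕ) : Function.Surjective ((toLocal R f).f n).hom :=
  (cokernel_π_surjective (openCylToRel R f) n).comp (cokernel_π_surjective _ n)

/-- Lets local homology be computed with chains of Cone_f itself, as needed for the subdivision
lemmas with `U = upper f` and `B` the cone point. -/
lemma toLocal_eq_zero_iff {n : ℕ} (z : (S R (MappingConeSpace f)).X n) :
    ((toLocal R f).f n).hom z = 0 ↔ z ∈ trivialChains f R n := by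
  constructor
  · intro h
    obtain ⟨u, hu⟩ := cokernel_π_eq_zero (openCylToRel R f) n (((toRel R f).f n).hom z) h
    rw [openCylToRel_apply, ← sub_eq_zero, ← map_sub] at hu
    obtain ⟨w, hw⟩ := cokernel_π_eq_zero _ n _ hu
    have hz : z = ((pushforward R (openCylToCone f)).f n).hom u +
        ((pushforward R (apexInclusion f)).f n).hom (-w) := by
      rw [map_neg, hw]; abel
    rw [hz]
    exact Submodule.add_mem_sup (pushforward_mem (openCylToCone f) (A := Set.univ) (fun (c : OpenCyl f) _ => c.2) (mem_subChains_univ u))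
      (pushforward_mem (apexInclusion f) (A := Set.univ) (fun _ _ => rfl) (mem_subChains_univ _))
  · intro h
    obtain ⟨a, ha, b, hb, rfl⟩ := Submodule.mem_sup.1 h
    obtain ⟨u, -, rfl⟩ := exists_pushforward_eq (openCylToCone f) (exists_openCyl_lift f) ha
    obtain ⟨w, -, rfl⟩ := exists_pushforward_eq (apexInclusion f) (exists_apex_lift f) hb
    rw [map_add]
    have h1 : ((toLocal R f).f n).hom (((pushforward R (openCylToCone f)).f n).hom u) = 0 :=
      comp_cokernel_π_apply (openCylToRel R f) n u
    have h2 : ((toLocal R f).f n).hom (((pushforward R (apexInclusion f)).f n).hom w) = 0 := by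
      change ((cokernel.π (openCylToRel R f)).f n).hom (((toRel R f).f n).hom _) = 0
      rw [toRel_apex, map_zero]
    rw [h1, h2, add_zero]

lemma toLocal_eq_iff {n : ℕ} (z w : (S R (MappingConeSpace f)).X n) :
    ((toLocal R f).f n).hom z = ((toLocal R f).f n).hom w ↔ z - w ∈ trivialChains f R n := by
  rw [← sub_eq_zero, ← map_sub, toLocal_eq_zero_iff]

variable (R) in
/-- The comparison of relative chains. -/
def relCompare : relChains R (𝟙 X) ⟶ relChains R f :=
  cokernel.map _ _ (𝟙 _) (pushforward R (coneCompare f)) (by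
    rw [pushforward_comp, apexInclusion_compare, Category.id_comp])

lemma toRel_compare :
    toRel R (𝟙 X) ≫ relCompare R f = pushforward R (coneCompare f) ≫ toRel R f :=
  cokernel.π_desc _ _ _

lemma openCylToRel_compare : openCylToRel R (𝟙 X) ≫ relCompare R f =
    pushforward R (openCylCompare f) ≫ openCylToRel R f := by
  rw [openCylToRel, openCylToRel, Category.assoc, toRel_compare, ← Category.assoc,
    pushforward_comp, openCylToCone_compare, ← pushforward_comp, Category.assoc]

variable (R) in
/-- The comparison of local chains. -/
def localCompare : localChains R (𝟙 X) ⟶ localChains R f :=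
  cokernel.map _ _ (pushforward R (openCylCompare f)) (relCompare R f) (openCylToRel_compare f)

lemma cokernel_π_localCompare : cokernel.π (openCylToRel R (𝟙 X)) ≫ localCompare R f =
    relCompare R f ≫ cokernel.π (openCylToRel R f) :=
  cokernel.π_desc _ _ _

lemma toLocal_compare :
    toLocal R (𝟙 X) ≫ localCompare R f = pushforward R (coneCompare f) ≫ toLocal R f := by
  rw [toLocal, toLocal, Category.assoc, cokernel_π_localCompare, ← Category.assoc, toRel_compare,
    Category.assoc]

lemma toLocal_compare_apply {n : ℕ} (z : (S R (MappingConeSpace (𝟙 X))).X n) :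
    ((localCompare R f).f n).hom (((toLocal R (𝟙 X)).f n).hom z) =
      ((toLocal R f).f n).hom (((pushforward R (coneCompare f)).f n).hom z) :=
  congrArg (fun g : S R (MappingConeSpace (𝟙 X)) ⟶ localChains R f => (g.f n).hom z)
    (toLocal_compare f)

lemma compare_mem_trivialChains {n : ℕ} {z : (S R (MappingConeSpace (𝟙 X))).X n}
    (hz : z ∈ trivialChains (𝟙 X) R n) :
    ((pushforward R (coneCompare f)).f n).hom z ∈ trivialChains f R n := by
  obtain ⟨a, ha, b, hb, rfl⟩ := Submodule.mem_sup.1 hz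
  rw [map_add]
  refine Submodule.add_mem_sup (pushforward_mem _ (fun c hc => ?_) ha)
    (pushforward_mem _ (fun c hc => ?_) hb)
  · change 0 < coneHeight f _
    rw [coneHeight_compare]
    exact hc
  · rw [Set.mem_singleton_iff] at hc
    rw [hc]
    rfl

/-- On simplices in the lower part the comparison is injective and preserves height, and height
detects both kinds of trivial simplex. -/
lemma mem_trivialChains_of_compare {n : ℕ} {z : (S R (MappingConeSpace (𝟙 X))).X n}
    (hz : z ∈ subChains R (lower (𝟙 X)) n)
    (h : ((pushforward R (coneCompare f)).f n).hom z ∈ trivialChains f R n) :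
    z ∈ trivialChains (𝟙 X) R n := by
  rw [trivialChains, supChains, subChains, subChains, ← spanOf_or] at h ⊢
  refine mem_spanOf_of_pushforward ?_ ?_ hz h
  · intro σ τ hσ hτ hst
    exact ContinuousMap.ext fun t =>
      coneCompare_injOn f (hσ ⟨t, rfl⟩) (hτ ⟨t, rfl⟩) (DFunLike.congr_fun hst t)
  · rintro σ - (hσ | hσ)
    · refine Or.inl ?_
      rintro _ ⟨t, rfl⟩
      have := hσ ⟨t, rfl⟩
      change 0 < coneHeight f (coneCompare f (σ t)) at this
      rwa [coneHeight_compare] at this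
    · refine Or.inr ?_
      rintro _ ⟨t, rfl⟩
      have h1 : coneCompare f (σ t) = mappingConeApex f := hσ ⟨t, rfl⟩
      refine coneHeight_eq_zero _ ?_
      rw [← coneHeight_compare f, h1, coneHeight_apex]

lemma toLocal_d {n m : ℕ} (z : (S R (MappingConeSpace f)).X n) :
    ((localChains R f).d n m).hom (((toLocal R f).f n).hom z) =
      ((toLocal R f).f m).hom (((S R (MappingConeSpace f)).d n m).hom z) :=
  hom_comm_apply _ _ _ _

/-- Excision: the comparison map of local chains is a quasi-isomorphism. -/
lemma quasiIso_localCompare : QuasiIso (localCompare R f) := by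
  have hlift : ∀ {n : ℕ} {v : (S R (MappingConeSpace f)).X n}, v ∈ subChains R (lower f) n →
      ∃ w ∈ subChains R (lower (𝟙 X)) n, ((pushforward R (coneCompare f)).f n).hom w = v :=
    fun hv => exists_pushforward_eq (coneCompare f)
      (fun σ hσ => exists_lift_compare f σ hσ) hv
  refine quasiIso_of_elements _ (fun n k hk l hl => ?_) fun n l hl => ?_
  · obtain ⟨z, rfl⟩ := toLocal_surjective (𝟙 X) n k
    obtain ⟨y, rfl⟩ := toLocal_surjective f (n + 1) l
    rw [toLocal_d, toLocal_eq_zero_iff] at hk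
    rw [toLocal_compare_apply, toLocal_d, toLocal_eq_iff] at hl
    obtain ⟨v, hv, y', hy'⟩ := exists_subChains_rep (isOpen_upper _) (isOpen_lower _)
      (upper_union_lower _) hk
    have hFv : ((pushforward R (coneCompare f)).f n).hom v ∈ subChains R (lower f) n := by
      refine pushforward_mem _ (fun c hc => ?_) hv
      change coneHeight f _ < 1
      rw [coneHeight_compare]
      exact hc
    have hb : ((pushforward R (coneCompare f)).f n).hom v -
        ((S R (MappingConeSpace f)).d (n + 1) n).hom
          (y - ((pushforward R (coneCompare f)).f (n + 1)).hom y') ∈ trivialChains f R n := by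
      have := sub_mem hl (compare_mem_trivialChains f hy')
      rw [map_sub, map_sub, ← hom_comm_apply] at this
      convert this using 1
      rw [map_sub]
      abel
    -- The bounding chain lives in Cone_f and need not lift; subdivision moves it into the lower
    -- part, where it does.
    obtain ⟨w, hw, hvw⟩ := exists_subChains_bound (isOpen_upper _) (isOpen_lower _)
      (upper_union_lower _) hFv hb
    obtain ⟨w', hw', rfl⟩ := hlift hw
    rw [hom_comm_apply, ← map_sub] at hvw
    have hT := mem_trivialChains_of_compare f (sub_mem hv (d_subChains hw')) hvw
    refine ⟨((toLocal R (𝟙 X)).f (n + 1)).hom (w' + y'), ?_⟩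
    rw [toLocal_d, eq_comm, toLocal_eq_iff]
    convert add_mem hy' hT using 1
    rw [map_add]
    abel
  · obtain ⟨z, rfl⟩ := toLocal_surjective f n l
    rw [toLocal_d, toLocal_eq_zero_iff] at hl
    obtain ⟨v, hv, y, hy⟩ := exists_subChains_rep (isOpen_upper _) (isOpen_lower _)
      (upper_union_lower _) hl
    obtain ⟨v', hv', rfl⟩ := hlift hv
    refine ⟨((toLocal R (𝟙 X)).f n).hom v', ?_, ((toLocal R f).f (n + 1)).hom y, ?_⟩
    · rw [toLocal_d, toLocal_eq_zero_iff]
      -- That the lift is a relative cycle is checked after mapping to Cone_f.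
      refine mem_trivialChains_of_compare f (d_subChains hv') ?_
      rw [← hom_comm_apply]
      have := sub_mem hl (d_supChains (j := n - 1) hy)
      rw [map_sub, map_sub, d_d_apply, sub_zero, sub_sub_cancel] at this
      exact this
    · rw [toLocal_compare_apply, toLocal_d, ← map_add, eq_comm, toLocal_eq_iff]
      convert hy using 1
      abel

/-! ### Naturality of `L` in `f` and the induced map of extensions. -/

variable (R) in
/-- The comparison of algebraic mapping cones. -/
def algConeCompare : algCone (pushforward R (𝟙 X)) ⟶ algCone (pushforward R f) :=
  algConeMap _ _ (𝟙 _) (pushforward R f) (by rw [pushforward_id])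

lemma l_compare (n : ℕ) : l R (𝟙 X) n ≫ (pushforward R (coneCompare f)).f n =
    (algConeCompare R f).f n ≫ l R f n := by
  cases n with
  | zero =>
    refine ModuleCat.hom_ext (LinearMap.ext fun (y : (S R X).X 0) => ?_)
    change ((pushforward R (coneCompare f)).f 0).hom (-((pushforward R (mapI (𝟙 X))).f 0).hom y) =
      -((pushforward R (mapI f)).f 0).hom (((pushforward R f).f 0).hom y)
    rw [map_neg, pushforward_comp_apply, pushforward_comp_apply, mapI_compare]
  | succ n =>
    refine ModuleCat.hom_ext (LinearMap.ext ?_)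
    rintro ⟨x, y⟩
    change ((pushforward R (coneCompare f)).f (n + 1)).hom
      (((pushforward R (mapJ (𝟙 X))).f (n + 1)).hom ((coneOp R X n).hom x) -
        ((pushforward R (mapI (𝟙 X))).f (n + 1)).hom y) =
      ((pushforward R (mapJ f)).f (n + 1)).hom ((coneOp R X n).hom x) -
        ((pushforward R (mapI f)).f (n + 1)).hom (((pushforward R f).f (n + 1)).hom y)
    rw [map_sub, pushforward_comp_apply, pushforward_comp_apply, pushforward_comp_apply,
      mapI_compare, mapJ_compare]

lemma mapL_compare : mapL R (𝟙 X) ≫ relCompare R f = algConeCompare R f ≫ mapL R f := by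
  refine HomologicalComplex.Hom.ext (funext fun n => ?_)
  rw [HomologicalComplex.comp_f, HomologicalComplex.comp_f, mapL_f, mapL_f,
    Preadditive.zsmul_comp, Preadditive.comp_zsmul, Category.assoc, ← HomologicalComplex.comp_f,
    toRel_compare, HomologicalComplex.comp_f, ← Category.assoc, l_compare, Category.assoc]

lemma algConeInrX_l (n : ℕ) : algConeInrX (pushforward R f) n ≫ l R f n =
    -(pushforward R (mapI f)).f n := by
  cases n with
  | zero => exact Category.id_comp _
  | succ n =>
    refine ModuleCat.hom_ext (LinearMap.ext fun y => ?_)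
    change ((pushforward R (mapJ f)).f (n + 1)).hom ((coneOp R X n).hom 0) -
      ((pushforward R (mapI f)).f (n + 1)).hom y = -((pushforward R (mapI f)).f (n + 1)).hom y
    rw [map_zero, map_zero, zero_sub]

lemma algConeInr_mapL : algConeInr (pushforward R f) ≫ mapL R f =
    (-pushforward R (baseToOpenCyl f)) ≫ openCylToRel R f := by
  refine HomologicalComplex.Hom.ext (funext fun n => ?_)
  rw [HomologicalComplex.comp_f, mapL_f, algConeInr_f, Preadditive.zsmul_comp,
    Preadditive.comp_zsmul, zsmul_neg_one_pow_mul_self, ← Category.assoc, algConeInrX_l,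
    openCylToRel, Preadditive.neg_comp, Preadditive.neg_comp, ← Category.assoc, pushforward_comp,
    baseToOpenCyl_comp]
  rfl

open scoped ZeroObject

variable (R) in
/-- The map from the shifted chains of `X` to the local chains at the cone point. -/
def shiftToLocal : algCone (0 : S R X ⟶ 0) ⟶ localChains R f :=
  (algCone_shortExact (pushforward R f)).gIsCokernel.desc
    (CokernelCofork.ofπ (mapL R f ≫ cokernel.π (openCylToRel R f)) (by
      change algConeInr (pushforward R f) ≫ _ = 0
      rw [← Category.assoc, algConeInr_mapL, Category.assoc, cokernel.condition, comp_zero]))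

lemma algConeProj_shiftToLocal : algConeProj (pushforward R f) ≫ shiftToLocal R f =
    mapL R f ≫ cokernel.π (openCylToRel R f) :=
  (algCone_shortExact (pushforward R f)).gIsCokernel.fac _ WalkingParallelPair.one

variable (R) in
/-- The map of short exact sequences induced by `L`. -/
def mapLShort :
    ShortComplex.mk (algConeInr (pushforward R f)) (algConeProj _) (algConeInr_proj _) ⟶
    ShortComplex.mk (openCylToRel R f) (cokernel.π (openCylToRel R f)) (cokernel.condition _) where
  τ₁ := -pushforward R (baseToOpenCyl f)
  τ₂ := mapL R f
  τ₃ := shiftToLocal R f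
  comm₁₂ := (algConeInr_mapL f).symm
  comm₂₃ := (algConeProj_shiftToLocal f).symm

lemma quasiIso_neg_baseToOpenCyl : QuasiIso (-pushforward R (baseToOpenCyl f)) := by
  have h := quasiIso_baseToOpenCyl R f
  rw [quasiIso_iff] at h ⊢
  intro n
  have := h n
  rw [quasiIsoAt_iff_isIso_homologyMap] at this ⊢
  rw [HomologicalComplex.homologyMap_neg]
  exact ⟨-inv (HomologicalComplex.homologyMap (pushforward R (baseToOpenCyl f)) n),
    by simp, by simp⟩

/-- The contraction makes the inclusion of the cone point a homotopy equivalence, so the quotient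
complex has no homology. -/
lemma relChains_id_acyclic : (relChains R (𝟙 X)).Acyclic := by
  have hq : QuasiIso (pushforward R (apexInclusion (𝟙 X))) :=
    quasiIso_pushforward_of_homotopy R _ (TopCat.ofHom (ContinuousMap.const _ PUnit.unit))
      (ContinuousMap.Homotopy.refl _) coneContraction
  exact (shortExact_cokernel (pushforward R (apexInclusion (𝟙 X)))).acyclic_X₃ hq

lemma quasiIso_mapL_id : QuasiIso (mapL R (𝟙 X)) := by
  refine quasiIso_of_acyclic _ (algCone_acyclic _ fun n => ?_) relChains_id_acyclic
  rw [pushforward_id]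
  exact Function.bijective_id

lemma algConeCompare_proj : algConeCompare R f ≫ algConeProj (pushforward R f) =
    algConeProj (pushforward R (𝟙 X)) := by
  refine HomologicalComplex.Hom.ext (funext fun n => ?_)
  cases n with
  | zero =>
    refine ModuleCat.hom_ext (LinearMap.ext fun y => ?_)
    exact (subsingleton_zero_X (R := R) 0).elim _ _
  | succ n =>
    refine ModuleCat.hom_ext (LinearMap.ext ?_)
    rintro ⟨x, y⟩
    exact Prod.ext rfl ((subsingleton_zero_X (R := R) (n + 1)).elim _ _)

/-- The projection from the algebraic cone of the identity is epi, so this reduces to naturality of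
L; the comparison of algebraic cones is the identity on the summand from `X`. -/
lemma shiftToLocal_compare :
    shiftToLocal R (𝟙 X) ≫ localCompare R f = shiftToLocal R f := by
  have := (algCone_shortExact (pushforward R (𝟙 X))).epi_g
  change Epi (algConeProj _) at this
  rw [← cancel_epi (algConeProj (pushforward R (𝟙 X))), ← Category.assoc,
    algConeProj_shiftToLocal, Category.assoc, cokernel_π_localCompare, ← Category.assoc,
    mapL_compare, Category.assoc, ← algConeProj_shiftToLocal, ← Category.assoc,
    algConeCompare_proj]

/-- For the identity two components of `mapLShort` are quasi-isomorphisms, hence so is the third;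
excision carries this to `f`. -/
lemma quasiIso_shiftToLocal : QuasiIso (shiftToLocal R f) := by
  have h₁ : QuasiIso (shiftToLocal R (𝟙 X)) :=
    HomologicalComplex.HomologySequence.quasiIso_τ₃ (mapLShort R (𝟙 X))
      (algCone_shortExact _) (shortExact_cokernel _) (quasiIso_neg_baseToOpenCyl _)
      quasiIso_mapL_id
  have h₂ := quasiIso_localCompare (R := R) f
  rw [← shiftToLocal_compare]
  infer_instance

variable (R) in
/-- `L` is a quasi-isomorphism. -/
lemma quasiIso_mapL : QuasiIso (mapL R f) :=
  quasiIso_τ₂ (mapLShort R f) (algCone_shortExact _) (shortExact_cokernel _)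
    (quasiIso_neg_baseToOpenCyl f) (quasiIso_shiftToLocal f)

end Excision

/-! ### Reduced homology -/

section Reduced

variable (R : Type u) [CommRing R] {X Y : TopCat.{u}} (f : X ⟶ Y)

lemma pushforward_apexInclusion_toPoint : pushforward R (apexInclusion f) ≫
    pushforward R (TopCat.ofHom (ContinuousMap.const (MappingConeSpace f) PUnit.unit)) =
      𝟙 (S R (TopCat.of PUnit.{u + 1})) :=
  (pushforward_comp R _ _).trans (pushforward_id R)

lemma toPointHomology_apex (n : ℕ) (c : (S R (TopCat.of PUnit.{u + 1})).homology n) :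
    (toPointHomology R (MappingConeSpace f) n).hom
      ((HomologicalComplex.homologyMap (pushforward R (apexInclusion f)) n).hom c) = c := by
  refine (homology_comp_apply _ _ n c).symm.trans ?_
  refine (congrArg (fun g : S R (TopCat.of PUnit.{u + 1}) ⟶ S R (TopCat.of PUnit.{u + 1}) =>
    (HomologicalComplex.homologyMap g n).hom c) (pushforward_apexInclusion_toPoint R f)).trans ?_
  rw [HomologicalComplex.homologyMap_id]
  rfl

lemma shortExact_toRel : (ShortComplex.mk (pushforward R (apexInclusion f)) (toRel R f)
    (cokernel.condition _)).ShortExact :=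
  shortExact_cokernel _

lemma toRel_homology_apex (n : ℕ) (c : (S R (TopCat.of PUnit.{u + 1})).homology n) :
    (HomologicalComplex.homologyMap (toRel R f) n).hom
      ((HomologicalComplex.homologyMap (pushforward R (apexInclusion f)) n).hom c) = 0 := by
  have h : pushforward R (apexInclusion f) ≫ toRel R f = 0 := cokernel.condition _
  rw [← homology_comp_apply, h, HomologicalComplex.homologyMap_zero]
  rfl

lemma exists_apex_of_toRel_eq_zero (n : ℕ) (x : (S R (MappingConeSpace f)).homology n)
    (hx : (HomologicalComplex.homologyMap (toRel R f) n).hom x = 0) :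
    ∃ c, (HomologicalComplex.homologyMap (pushforward R (apexInclusion f)) n).hom c = x := by
  have e := (shortExact_toRel R f).homology_exact₂ n
  rw [ShortComplex.moduleCat_exact_iff] at e
  exact e x hx

/-- The connecting map lands in the kernel of the map induced by the inclusion of the cone point.
That kernel is zero because the point is a retract. -/
lemma toRel_homology_surjective (n : ℕ) :
    Function.Surjective (HomologicalComplex.homologyMap (toRel R f) n).hom := by
  cases n with
  | zero =>
    have : Epi (toRel R f) := inferInstanceAs (Epi (cokernel.π _))
    exact (ModuleCat.epi_iff_surjective _).1
      (HomologicalComplex.epi_homologyMap_of_epi_of_not_rel (toRel R f) 0 (by simp))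
  | succ n =>
    intro y
    have e := (shortExact_toRel R f).homology_exact₃ (n + 1) n (by simp)
    rw [ShortComplex.moduleCat_exact_iff] at e
    refine e y ?_
    have h : (HomologicalComplex.homologyMap (pushforward R (apexInclusion f)) n).hom
        (((shortExact_toRel R f).δ (n + 1) n (by simp)).hom y) = 0 :=
      congrArg (fun g => g.hom y) ((shortExact_toRel R f).δ_comp (n + 1) n (by simp))
    have h' := congrArg (toPointHomology R (MappingConeSpace f) n).hom h
    rw [toPointHomology_apex, map_zero] at h'
    exact h'

lemma isIso_reduced (n : ℕ) : IsIso (kernel.ι (toPointHomology R (MappingConeSpace f) n) ≫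
    HomologicalComplex.homologyMap (toRel R f) n) := by
  have hmem : ∀ x, (toPointHomology R (MappingConeSpace f) n).hom
      ((kernel.ι (toPointHomology R (MappingConeSpace f) n)).hom x) = 0 := fun x =>
    congrArg (fun g => g.hom x) (kernel.condition (toPointHomology R (MappingConeSpace f) n))
  have hinj : Function.Injective (kernel.ι (toPointHomology R (MappingConeSpace f) n)).hom :=
    (ModuleCat.mono_iff_injective _).1 inferInstance
  have hsurj : ∀ x, (toPointHomology R (MappingConeSpace f) n).hom x = 0 →
      ∃ y, (kernel.ι (toPointHomology R (MappingConeSpace f) n)).hom y = x := by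
    have e := ShortComplex.exact_kernel (toPointHomology R (MappingConeSpace f) n)
    rw [ShortComplex.moduleCat_exact_iff] at e
    exact e
  refine (ConcreteCategory.isIso_iff_bijective _).2 ⟨?_, fun y => ?_⟩
  · refine (injective_iff_map_eq_zero (ModuleCat.Hom.hom
      (kernel.ι (toPointHomology R (MappingConeSpace f) n) ≫
        HomologicalComplex.homologyMap (toRel R f) n))).2 fun x hx => ?_
    obtain ⟨c, hc⟩ := exists_apex_of_toRel_eq_zero R f n
      ((kernel.ι (toPointHomology R (MappingConeSpace f) n)).hom x) hx
    have h := hmem x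
    rw [← hc, toPointHomology_apex] at h
    refine hinj ?_
    rw [← hc, h, map_zero, map_zero]
  · obtain ⟨x, rfl⟩ := toRel_homology_surjective R f n y
    -- Subtracting the class that `x` induces at the cone point makes it reduced without changing
    -- its relative class.
    obtain ⟨z, hz⟩ := hsurj (x - (HomologicalComplex.homologyMap
      (pushforward R (apexInclusion f)) n).hom
      ((toPointHomology R (MappingConeSpace f) n).hom x)) (by
        rw [map_sub, toPointHomology_apex, sub_self])
    refine ⟨z, ?_⟩
    change (HomologicalComplex.homologyMap (toRel R f) n).hom 
      ((kernel.ι (toPointHomology R (MappingConeSpace f) n)).hom z) = _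
    rw [hz, map_sub, toRel_homology_apex, sub_zero]

lemma isIso_toRel_homology {n : ℕ} (hn : 1 ≤ n) :
    IsIso (HomologicalComplex.homologyMap (toRel R f) n) := by
  have hz : IsZero ((S R (TopCat.of PUnit.{u + 1})).homology n) :=
    isZero_singularHomologyFunctor_of_totallyDisconnectedSpace _ n (ModuleCat.of R R) _ (by omega)
  have hs := ModuleCat.subsingleton_of_isZero hz
  refine (ConcreteCategory.isIso_iff_bijective _).2 ⟨?_, toRel_homology_surjective R f n⟩
  refine (injective_iff_map_eq_zero
    (HomologicalComplex.homologyMap (toRel R f) n).hom).2 fun x hx => ?_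
  obtain ⟨c, rfl⟩ := exists_apex_of_toRel_eq_zero R f n x hx
  rw [Subsingleton.elim c 0, map_zero]

end Reduced

end MappingCone

end

/-! ### The main theorem. -/

open CategoryTheory CategoryTheory.Limits MappingCone in
theorem mainTheorem7 (R : Type u) [CommRing R] {X Y : TopCat.{u}} (f : X ⟶ Y) :
    (∀ n : ℕ, 1 ≤ n →
      l R f (n + 1) ≫ (S R (MappingConeSpace f)).d (n + 1) n +
        (algCone (pushforward R f)).d (n + 1) n ≫ l R f n = 0) ∧
    (∀ n : ℕ,
      (l R f (n + 1) ≫ (toRel R f).f (n + 1)) ≫ (relChains R f).d (n + 1) n +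
        (algCone (pushforward R f)).d (n + 1) n ≫ (l R f n ≫ (toRel R f).f n) = 0) ∧
    ∃ L : algCone (pushforward R f) ⟶ relChains R f,
      (∀ n : ℕ, L.f n = (-1 : ℤ) ^ n • (l R f n ≫ (toRel R f).f n)) ∧
      QuasiIso L ∧
      (∀ n : ℕ, ∃ e : mapHomology R f n ≅ reducedHomology R (MappingConeSpace f) n,
        e.hom ≫ kernel.ι (toPointHomology R (MappingConeSpace f) n) ≫
          HomologicalComplex.homologyMap (toRel R f) n = HomologicalComplex.homologyMap L n) ∧
      (∀ n : ℕ, 1 ≤ n →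
        ∃ e : mapHomology R f n ≅ (S R (MappingConeSpace f)).homology n,
          e.hom ≫ HomologicalComplex.homologyMap (toRel R f) n =
            HomologicalComplex.homologyMap L n) := by
  have hL := quasiIso_mapL R f
  refine ⟨fun n hn => l_comp_d R f hn, l_toRel_comp_d R f, mapL R f, mapL_f R f, hL,
    fun n => ?_, fun n hn => ?_⟩
  · have := isIso_reduced R f n
    exact ⟨asIso (HomologicalComplex.homologyMap (mapL R f) n) ≪≫
      (asIso (kernel.ι (toPointHomology R (MappingConeSpace f) n) ≫
        HomologicalComplex.homologyMap (toRel R f) n)).symm, by simp⟩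
  · have := isIso_toRel_homology R f hn
    exact ⟨asIso (HomologicalComplex.homologyMap (mapL R f) n) ≪≫
      (asIso (HomologicalComplex.homologyMap (toRel R f) n)).symm, by simp⟩
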